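/- **Setting.** Let $1\le m\le d$ and let $\mathcal A$ be a nonempty family of $m$-element subsets ("actions") of the set of arms $[d]=\{1,\dots,d\}$; an action is identified with its indicator vector in $\{0,1\}^d$. The reward vectors $X_1,X_2,\dots\in\mathbb R^d$ are i.i.d. with mean $\mu$, and there is a positive semi-definite matrix $C$ with $\mathbb E[e^{u^\top(X_t-\mu)}]\le e^{\frac12u^\top Cu}$ for all $u\in\mathbb R^d$. Let $\Gamma$ be a known positive semi-definite matrix with non-negative entries such that $v^\top Cv\le v^\top\Gamma v$ for all vectors $v$ with positive coordinates. Let $A^*$ be an action maximizing $A^\top\mu$ over $\mathcal A$, and let $\Delta_A=A^{*\top}\mu-A^\top\mu$, $\Delta_{\max}=\max_{A\in\mathcal A}\Delta_A$, $\Delta_{\min}=\min\{\Delta_A:A\in\mathcal A,\ \Delta_A>0\}$ and $\Delta_{i,\min}=\min\{\Delta_A:A\in\mathcal A,\ i\in A,\ \Delta_A>0\}$, where $\Gamma^{(ii)}/\Delta_{i,\min}$ is read as $0$ if no suboptimal action contains $i$, and $\Delta_{\max}/\Delta_{\min}^2$ is read as $0$ if all actions are optimal. **Algorithm.** Let $\lambda>0$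 and $f(t)=\log t+(m+2)\log\log t+\frac m2\log(1+\frac e\lambda)$. OLS-UCB chooses the action $A_t\in\mathcal A$ of stage $t\ge1$ on the basis of the past, and then observes $X_t^{(i)}$ for $i\in A_t$. In an initialization phase, the stages $1,\dots,\tau$, it chooses arbitrary actions such that each arm is pulled at least once. At each stage $t>\tau$ it chooses, with ties broken arbitrarily, $$A_t\in\arg\max_{A\in\mathcal A}\ A^\top\hat\mu_t+\sqrt{2f(t)}\sqrt{A^\top D_t^{-1}\Big(\lambda\Sigma_\Gamma D_t+\sum_{s=1}^{t-1}I_{A_s}\Gamma I_{A_s}\Big)D_t^{-1}A},$$ where $\hat\mu_t^{(i)}$ is the average of the rewards $X_s^{(i)}$ over the stages $s<t$ with $i\in A_s$, $I_A$ is the diagonal matrix with diagonal $A$, $D_t=\sum_{s=1}^{t-1}I_{A_s}$, and $\Sigma_\Gamma$ is the diagonal part of $\Gamma$. **Theorem.** Let $\Delta_t=\Delta_{A_t}$ and $R_T=\sum_{t=1}^T\Delta_t$, and let $$\gamma=\max_{t\le T}\ \max_{i,j\in A_t,\ i\ne j}\frac{\Gamma^{(ij)}}{\sqrt{\Gamma^{(ii)}\Gamma^{(jj)}}}\in[0,1]$$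 (with $0/0=0$, and $\gamma=0$ if $m=1$). For every $T\ge1$, $$\begin{aligned}\mathbb E[R_T]\le{}&\mathbb E\Big[\sum_{t=1}^{\min(\tau,T)}\Delta_t\Big]+16f(T)^+\sum_{i\in[d]}\frac{\Gamma^{(ii)}}{\Delta_{i,\min}}\ \mathbb E\Big[5(\lambda+1-\gamma)\Big\lceil\frac{\log m}{1.6}\Big\rceil^2+45\gamma m\Big]\\&+\frac{8dm^2\max_i\{C^{(ii)}\}\Delta_{\max}}{\Delta_{\min}^2}+4\Delta_{\max},\end{aligned}$$ where $\lceil x\rceil$ is the smallest positive integer that is at least $x$ (so $\lceil0\rceil=1$) and $f(T)^+=\max(f(T),0)$, which equals $f(T)$ for all $T\ge3$ (for $T=1$, where $\log\log T$ is undefined, that term of $f$ is read as $0$). -/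

import Mathlib

open MeasureTheory ProbabilityTheory

noncomputable section

namespace SemiBandit

open scoped Matrix

/-- The set of available actions: a nonempty family of sets of exactly `m` arms among `d`. -/
structure ActionSet (d m : ℕ) where
  acts : Finset (Finset (Fin d))
  nonempty : acts.Nonempty
  card_eq : ∀ A ∈ acts, A.card = m

variable {d m : ℕ} {Ω : Type*}

/-- The mean reward `Aᵀ μ` of an action. -/
def meanReward (μ : Fin d → ℝ) (A : Finset (Fin d)) : ℝ := ∑ i ∈ A, μ i

/-- The gap `Δ_A = A*ᵀ μ - Aᵀ μ`, where `A*` is an action of maximal mean. -/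
def gap (𝒜 : ActionSet d m) (μ : Fin d → ℝ) (A : Finset (Fin d)) : ℝ :=
  𝒜.acts.sup' 𝒜.nonempty (meanReward μ) - meanReward μ A

/-- The largest gap. -/
def gapMax (𝒜 : ActionSet d m) (μ : Fin d → ℝ) : ℝ :=
  𝒜.acts.sup' 𝒜.nonempty (gap 𝒜 μ)

/-- The set of gaps of suboptimal actions. -/
def posGaps (𝒜 : ActionSet d m) (μ : Fin d → ℝ) : Set ℝ :=
  {x | ∃ A ∈ 𝒜.acts, 0 < gap 𝒜 μ A ∧ x = gap 𝒜 μ A}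

/-- The smallest gap of a suboptimal action. If there is no suboptimal action the value is
immaterial, because then `gapMax` vanishes. -/
def gapMin (𝒜 : ActionSet d m) (μ : Fin d → ℝ) : ℝ := sInf (posGaps 𝒜 μ)

/-- The gaps of the suboptimal actions that contain arm `i`. -/
def armPosGaps (𝒜 : ActionSet d m) (μ : Fin d → ℝ) (i : Fin d) : Set ℝ :=
  {x | ∃ A ∈ 𝒜.acts, i ∈ A ∧ 0 < gap 𝒜 μ A ∧ x = gap 𝒜 μ A}

/-- The minimal gap `Δ_{i,min}` of arm `i`, over the suboptimal actions that contain it. -/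
def armGapMin (𝒜 : ActionSet d m) (μ : Fin d → ℝ) (i : Fin d) : ℝ :=
  sInf (armPosGaps 𝒜 μ i)

/-- `∑ i, Γ^{(ii)} / Δ_{i,min}`, over the arms that belong to some suboptimal action (for the
other arms the minimum is over the empty set, `Δ_{i,min} = ∞`, and the term is `0`). -/
def complexity (𝒜 : ActionSet d m) (μ : Fin d → ℝ) (Γ : Matrix (Fin d) (Fin d) ℝ) : ℝ :=
  open Classical in
  ∑ i ∈ Finset.univ.filter (fun i => (armPosGaps 𝒜 μ i).Nonempty), Γ i i / armGapMin 𝒜 μ i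

/-- `C ⪯₊ Γ`. -/
def LePos (C Γ : Matrix (Fin d) (Fin d) ℝ) : Prop :=
  ∀ v : Fin d → ℝ, (∀ i, 0 < v i) → v ⬝ᵥ (C *ᵥ v) ≤ v ⬝ᵥ (Γ *ᵥ v)

/-- The reward vectors `X 1, X 2, …` are i.i.d. with mean `μ`, their noise has subgaussian
covariance matrix `C`, and `X (t + 1)` is independent of the information `ℱ t` that is available
after stage `t` (which contains `X 1, …, X t` and possibly external randomness). -/
structure IsRewardProcess [mΩ : MeasurableSpace Ω] (P : Measure Ω) (ℱ : Filtration ℕ mΩ)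
    (X : ℕ → Ω → Fin d → ℝ) (μ : Fin d → ℝ) (C : Matrix (Fin d) (Fin d) ℝ) : Prop where
  adapted : ∀ t, Measurable[ℱ (t + 1)] (X (t + 1))
  indep : ∀ t, Indep (MeasurableSpace.comap (X (t + 1)) inferInstance) (ℱ t) P
  identDistrib : ∀ t, 1 ≤ t → IdentDistrib (X t) (X 1) P P
  integrable : ∀ t, 1 ≤ t → ∀ i, Integrable (fun ω => X t ω i) P
  mean : ∀ t, 1 ≤ t → ∀ i, ∫ ω, X t ω i ∂P = μ i
  posSemidef : C.PosSemidef
  exp_integrable : ∀ t, 1 ≤ t → ∀ u : Fin d → ℝ,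
    Integrable (fun ω => Real.exp (u ⬝ᵥ (X t ω - μ))) P
  subgaussian : ∀ t, 1 ≤ t → ∀ u : Fin d → ℝ,
    ∫ ω, Real.exp (u ⬝ᵥ (X t ω - μ)) ∂P ≤ Real.exp ((1 / 2) * (u ⬝ᵥ (C *ᵥ u)))

/-- The indicator vector of an action in `{0,1}^d`. -/
def vec (A : Finset (Fin d)) : Fin d → ℝ := fun i => if i ∈ A then 1 else 0

/-- The diagonal matrix `I_A`. -/
def proj (A : Finset (Fin d)) : Matrix (Fin d) (Fin d) ℝ := Matrix.diagonal (vec A)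

/-- The number of pulls of arm `i` before stage `t`, along the sequence of actions `a 1, a 2, …`. -/
def pulls (a : ℕ → Finset (Fin d)) (t : ℕ) (i : Fin d) : ℕ :=
  ((Finset.Ico 1 t).filter (fun s => i ∈ a s)).card

/-- The diagonal matrix `D_t = ∑_{s < t} I_{A_s}` of the numbers of pulls. -/
def design (a : ℕ → Finset (Fin d)) (t : ℕ) : Matrix (Fin d) (Fin d) ℝ :=
  ∑ s ∈ Finset.Ico 1 t, proj (a s)

/-- The least squares estimator of the mean of arm `i` at stage `t`. -/
def muHat (a : ℕ → Finset (Fin d)) (x : ℕ → Fin d → ℝ) (t : ℕ) (i : Fin d) : ℝ :=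
  (∑ s ∈ (Finset.Ico 1 t).filter (fun s => i ∈ a s), x s i) / (pulls a t i : ℝ)

/-- `f(t) = log t + (m + 2) log log t + (m / 2) log (1 + e / lam)`. -/
def explore (m : ℕ) (lam : ℝ) (t : ℕ) : ℝ :=
  Real.log t + (m + 2) * Real.log (Real.log t) + (m / 2) * Real.log (1 + Real.exp 1 / lam)

/-- The exploration term
`E_t(A) = √(2 f(t)) √(Aᵀ D_t⁻¹ (lam Σ_Γ D_t + ∑_{s < t} Γ_{A_s}) D_t⁻¹ A)`,
where `Σ_Γ` is the diagonal part of `Γ` and `Γ_A = I_A Γ I_A`. -/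
def bonus (m : ℕ) (Γ : Matrix (Fin d) (Fin d) ℝ) (lam : ℝ) (a : ℕ → Finset (Fin d)) (t : ℕ)
    (A : Finset (Fin d)) : ℝ :=
  Real.sqrt (2 * explore m lam t) *
    Real.sqrt (vec A ⬝ᵥ
      (((design a t)⁻¹ *
        (lam • (Matrix.diagonal (fun i => Γ i i) * design a t) +
          ∑ s ∈ Finset.Ico 1 t, proj (a s) * Γ * proj (a s)) *
        (design a t)⁻¹) *ᵥ vec A))

/-- The index `Aᵀ μ̂_t + E_t(A)` of an action at stage `t`. -/
def index (m : ℕ) (Γ : Matrix (Fin d) (Fin d) ℝ) (lam : ℝ) (a : ℕ → Finset (Fin d))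
    (x : ℕ → Fin d → ℝ) (t : ℕ) (A : Finset (Fin d)) : ℝ :=
  (∑ i ∈ A, muHat a x t i) + bonus m Γ lam a t A

/-- The actions `A 1, A 2, …` are those of a run of OLS-UCB with matrix `Γ` and parameter `lam`:
the action of each stage is chosen from the information available before that stage; during an
initialization phase, the stages `1, …, τ`, the actions are arbitrary but such that each arm is
pulled at least once; at each later stage an action of maximal index is chosen, with ties broken
in any way. -/
structure IsOLSUCB [mΩ : MeasurableSpace Ω] (𝒜 : ActionSet d m)
    (Γ : Matrix (Fin d) (Fin d) ℝ) (lam : ℝ) (ℱ : Filtration ℕ mΩ) (X : ℕ → Ω → Fin d → ℝ)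
    (A : ℕ → Ω → Finset (Fin d)) (τ : Ω → ℕ) : Prop where
  mem : ∀ t, 1 ≤ t → ∀ ω, A t ω ∈ 𝒜.acts
  predictable : ∀ t B, MeasurableSet[ℱ t] {ω | A (t + 1) ω = B}
  stopping : ∀ k, MeasurableSet[ℱ k] {ω | τ ω ≤ k}
  init : ∀ ω i, ∃ s, 1 ≤ s ∧ s ≤ τ ω ∧ i ∈ A s ω
  argmax : ∀ ω t, τ ω < t → ∀ B ∈ 𝒜.acts,
    index m Γ lam (fun s => A s ω) (fun s => X s ω) t B ≤
      index m Γ lam (fun s => A s ω) (fun s => X s ω) t (A t ω)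

/-- The maximal off-diagonal correlation coefficient of `Γ_A`; it is `0` if `A` has one arm. -/
def corr (Γ : Matrix (Fin d) (Fin d) ℝ) (A : Finset (Fin d)) : ℝ :=
  ⨆ p : A.offDiag, Γ p.1.1 p.1.2 / Real.sqrt (Γ p.1.1 p.1.1 * Γ p.1.2 p.1.2)

/-- The maximum `γ` of the correlation coefficients of the actions of the stages `1, …, T`. -/
def maxCorr (Γ : Matrix (Fin d) (Fin d) ℝ) (a : ℕ → Finset (Fin d)) (T : ℕ) : ℝ :=
  ⨆ t : Finset.Icc 1 T, corr Γ (a t)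

/-- The smallest positive integer that is at least `x`. -/
def posCeil (x : ℝ) : ℕ := max 1 ⌈x⌉₊

/-- The regret accumulated during the first `T` stages of a run `a 1, a 2, …`. -/
def regret (𝒜 : ActionSet d m) (μ : Fin d → ℝ) (a : ℕ → Finset (Fin d)) (T : ℕ) : ℝ :=
  ∑ t ∈ Finset.Icc 1 T, gap 𝒜 μ (a t)

end SemiBandit

end

noncomputable section

namespace SemiBandit

open scoped Matrix

variable {d m : ℕ} {Ω : Type*}

/-! Let `B` be an optimal action and `ε = Δ_min / (2m)`. After initialization, a stage with positive
gap falls into one of three classes: the index of `B` is below its mean; some arm of the played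
action has an empirical mean exceeding its true mean by at least `ε`; or neither. In the last case
`meanReward μ B ≤ index B ≤ index A_t ≤ meanReward μ A_t + Δ_min / 2 + bonus`, and since `Δ_min ≤
Δ_t` this gives `Δ_t ≤ 2 * bonus` (`gap_le_two_mul_bonus`).

Underestimation of `B` is controlled by the method of mixtures. For each deterministic vector `u`,
restricted to the arms of `B` played at each stage, the compensated exponential of the noise has
expectation at most one. Averaging over a Gaussian law of `u` with independent coordinates gives a
self-normalized bound valid for all directions at once (`measure_self_normalized_le`). The direction
of interest has coordinates `1 / N_i` with random counts `N_i`, so the counts are localized in a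
geometric grid with `⌊log t⌋ ^ m` cells. The union bound over cells is paid for by `explore` and
leaves the summable `1 / (t log² t)` (`measure_index_lt_meanReward_le`).

Overestimation of one arm is a Chernoff bound for each number `n` of pulls. Its sum over `n` is at
most `2 C_ii / ε²`, and each pair `(i, n)` spoils at most one stage
(`sum_measure_deviationEvent_le`, `sum_charge_le`).

In the remaining stages `Δ_t²` is at most `8 f` times a mixture of `∑ Γ_ii / N_i` and `(∑ √(Γ_ii /
N_i))²`, with weights `λ + 1 - γ` and `γ` (`widthSq_le`). According to which part dominates, the gap
is distributed over the arms played so that an arm pays only while its count is below a threshold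
(`gap_le_sum_charge_of_sum`, `gap_le_sum_charge_of_sq_sum`). Summing the payments over counts gives
the logarithmic term (`sum_gap_le_of_gap_le_bonus`). -/

/-! ### Exponential supermartingales of the noise. -/

/-- Exponentials of predictable linear functionals of the noise, compensated by the subgaussian
bound, have expectation at most one. -/
theorem lintegral_exp_compensated_le_one [mΩ : MeasurableSpace Ω] {P : Measure Ω}
    [IsProbabilityMeasure P] {ℱ : Filtration ℕ mΩ} {X : ℕ → Ω → Fin d → ℝ} {μ : Fin d → ℝ}
    {C : Matrix (Fin d) (Fin d) ℝ} (hX : IsRewardProcess P ℱ X μ C)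
    {U : ℕ → Ω → Fin d → ℝ} (hU : ∀ t, Measurable[ℱ t] (U (t + 1)))
    (hfin : ∀ t, (Set.range (U (t + 1))).Finite) (n : ℕ) :
    ∫⁻ ω, ENNReal.ofReal (Real.exp (∑ s ∈ Finset.Ico 1 (n + 1),
      (U s ω ⬝ᵥ (X s ω - μ) - 1 / 2 * (U s ω ⬝ᵥ (C *ᵥ U s ω))))) ∂P ≤ 1 := by
  induction n with
  | zero => simp
  | succ n ih =>
    set Z : Ω → ENNReal := fun ω => ENNReal.ofReal (Real.exp (∑ s ∈ Finset.Ico 1 (n + 1),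
      (U s ω ⬝ᵥ (X s ω - μ) - 1 / 2 * (U s ω ⬝ᵥ (C *ᵥ U s ω))))) with hZ
    have hdot : ∀ {m' : MeasurableSpace Ω} {f g : Ω → Fin d → ℝ}, Measurable[m'] f →
        Measurable[m'] g → Measurable[m'] (fun ω => f ω ⬝ᵥ g ω) := by
      intro m' f g hf hg
      unfold dotProduct
      fun_prop
    have hmv : ∀ {m' : MeasurableSpace Ω} {f : Ω → Fin d → ℝ}, Measurable[m'] f →
        Measurable[m'] (fun ω => C *ᵥ f ω) := by
      intro m' f hf
      unfold Matrix.mulVec dotProduct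
      fun_prop
    have hZm : Measurable[ℱ n] Z := by
      refine ENNReal.measurable_ofReal.comp (Real.measurable_exp.comp ?_)
      refine Finset.measurable_sum _ fun s hs => ?_
      obtain ⟨h1, h2⟩ := Finset.mem_Ico.1 hs
      obtain ⟨k, rfl⟩ : ∃ k, s = k + 1 := ⟨s - 1, by omega⟩
      have hUk : Measurable[ℱ n] (U (k + 1)) := (hU k).mono (ℱ.mono (by omega)) le_rfl
      have hXk : Measurable[ℱ n] (X (k + 1)) := (hX.adapted k).mono (ℱ.mono (by omega)) le_rfl
      exact (hdot hUk (hXk.sub measurable_const)).sub ((hdot hUk (hmv hUk)).const_mul _)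
    set R := (hfin n).toFinset with hR
    let g : (Fin d → ℝ) → (Fin d → ℝ) → ENNReal := fun v x =>
      ENNReal.ofReal (Real.exp (v ⬝ᵥ (x - μ) - 1 / 2 * (v ⬝ᵥ (C *ᵥ v))))
    have hgm : ∀ v, Measurable (g v) := by
      intro v
      refine ENNReal.measurable_ofReal.comp (Real.measurable_exp.comp ?_)
      unfold dotProduct
      fun_prop
    have hg1 : ∀ v, ∫⁻ ω, g v (X (n + 1) ω) ∂P ≤ 1 := by
      intro v
      have hi := hX.exp_integrable (n + 1) (by omega) v
      have hs := hX.subgaussian (n + 1) (by omega) v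
      have e : ∀ ω, g v (X (n + 1) ω) = ENNReal.ofReal (Real.exp (-(1 / 2 * (v ⬝ᵥ (C *ᵥ v))))) *
          ENNReal.ofReal (Real.exp (v ⬝ᵥ (X (n + 1) ω - μ))) := by
        intro ω
        rw [← ENNReal.ofReal_mul (Real.exp_nonneg _), ← Real.exp_add]
        simp only [g]
        congr 2
        ring
      simp_rw [e]
      rw [lintegral_const_mul' _ _ ENNReal.ofReal_ne_top,
        ← ofReal_integral_eq_lintegral_ofReal hi
          (Filter.Eventually.of_forall fun ω => Real.exp_nonneg _),
        ← ENNReal.ofReal_mul (Real.exp_nonneg _), ← ENNReal.ofReal_one]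
      refine ENNReal.ofReal_le_ofReal ?_
      calc _ ≤ Real.exp (-(1 / 2 * (v ⬝ᵥ (C *ᵥ v)))) * Real.exp ((1 / 2) * (v ⬝ᵥ (C *ᵥ v))) := by
            gcongr
        _ = 1 := by rw [← Real.exp_add]; simp
    have hset : ∀ v, MeasurableSet[ℱ n] {ω | U (n + 1) ω = v} := fun v =>
      hU n (measurableSet_singleton v)
    -- Splitting on the finitely many values `v` of the predictable direction leaves a deterministic
    -- `v` in the last factor, so independence of `X (n + 1)` and `ℱ n` factorizes each expectation.
    have hsplit : ∀ ω (F : (Fin d → ℝ) → ENNReal), F (U (n + 1) ω) =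
        ∑ v ∈ R, {ω | U (n + 1) ω = v}.indicator (fun _ => F v) ω := by
      intro ω F
      rw [Finset.sum_eq_single (U (n + 1) ω)]
      · simp
      · intro b _ hb
        simp [hb.symm]
      · intro h
        exact absurd (by simp [hR]) h
    calc ∫⁻ ω, ENNReal.ofReal (Real.exp (∑ s ∈ Finset.Ico 1 (n + 1 + 1),
        (U s ω ⬝ᵥ (X s ω - μ) - 1 / 2 * (U s ω ⬝ᵥ (C *ᵥ U s ω))))) ∂P
        = ∫⁻ ω, ∑ v ∈ R, ({ω | U (n + 1) ω = v}.indicator (fun ω => Z ω) ω) *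
            g v (X (n + 1) ω) ∂P := by
          refine lintegral_congr fun ω => ?_
          rw [Finset.sum_Ico_succ_top (by omega), Real.exp_add,
            ENNReal.ofReal_mul (Real.exp_nonneg _)]
          change Z ω * g (U (n + 1) ω) (X (n + 1) ω) = _
          rw [hsplit ω (fun v => g v (X (n + 1) ω)), Finset.mul_sum]
          refine Finset.sum_congr rfl fun v _ => ?_
          by_cases h : U (n + 1) ω = v <;> simp [h]
      _ = ∑ v ∈ R, ∫⁻ ω, ({ω | U (n + 1) ω = v}.indicator (fun ω => Z ω) ω) *
            g v (X (n + 1) ω) ∂P := by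
          refine lintegral_finsetSum _ fun v _ => ?_
          refine Measurable.mul ?_ ((hgm v).comp ((hX.adapted n).mono (ℱ.le _) le_rfl))
          exact ((hZm.mono (ℱ.le _) le_rfl).indicator (ℱ.le _ _ (hset v)))
      _ ≤ ∑ v ∈ R, ∫⁻ ω, ({ω | U (n + 1) ω = v}.indicator (fun ω => Z ω) ω) ∂P := by
          refine Finset.sum_le_sum fun v _ => ?_
          have hcm : Measurable[MeasurableSpace.comap (X (n + 1)) inferInstance]
              (fun ω => g v (X (n + 1) ω)) := (hgm v).comp (comap_measurable _)
          rw [lintegral_mul_eq_lintegral_mul_lintegral_of_independent_measurableSpace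
            (ℱ.le n) (((hX.adapted n).mono (ℱ.le _) le_rfl).comap_le) (hX.indep n).symm
            (hZm.indicator (hset v)) hcm]
          exact mul_le_of_le_one_right' (hg1 v)
      _ = ∫⁻ ω, Z ω ∂P := by
          rw [← lintegral_finsetSum]
          · refine lintegral_congr fun ω => ?_
            rw [hsplit ω (fun _ => Z ω)]
            rfl
          · intro v _
            exact ((hZm.mono (ℱ.le _) le_rfl).indicator (ℱ.le _ _ (hset v)))
      _ ≤ 1 := ih

/-- A function of the actions of the stages `1, …, n + 1` is known before stage `n + 1`, and it
has finitely many values. -/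
theorem measurable_of_actions [mΩ : MeasurableSpace Ω] {ℱ : Filtration ℕ mΩ}
    {A : ℕ → Ω → Finset (Fin d)} (hA : ∀ t B, MeasurableSet[ℱ t] {ω | A (t + 1) ω = B})
    {β : Type*} [MeasurableSpace β] {n : ℕ} {H : (ℕ → Finset (Fin d)) → β}
    (hH : ∀ a b : ℕ → Finset (Fin d), (∀ s ∈ Finset.Icc 1 (n + 1), a s = b s) → H a = H b) :
    Measurable[ℱ n] (fun ω => H (fun s => A s ω)) ∧
      (Set.range (fun ω => H (fun s => A s ω))).Finite := by
  -- `H` factors through the finite type of tuples of the first `n + 1` actions; the value `∅` at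
  -- other stages is never seen by `H`.
  let ext : (Fin (n + 1) → Finset (Fin d)) → ℕ → Finset (Fin d) := fun b s =>
    if h : 1 ≤ s ∧ s ≤ n + 1 then b ⟨s - 1, by omega⟩ else ∅
  let h : Ω → (Fin (n + 1) → Finset (Fin d)) := fun ω k => A (k + 1) ω
  have e : (fun ω => H (fun s => A s ω)) = (fun b => H (ext b)) ∘ h := by
    funext ω
    refine hH _ _ fun s hs => ?_
    obtain ⟨h1, h2⟩ := Finset.mem_Icc.1 hs
    simp only [ext, h, h1, h2, and_self, dif_pos]
    congr 1
    omega
  rw [e]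
  constructor
  · let _ : MeasurableSpace (Fin (n + 1) → Finset (Fin d)) := ⊤
    have hh : Measurable[ℱ n] h := by
      refine @measurable_to_countable' _ _ _ _ (ℱ n) _ fun b => ?_
      have : h ⁻¹' {b} = ⋂ k : Fin (n + 1), {ω | A (k + 1) ω = b k} := by
        ext ω
        simp [h, funext_iff]
      rw [this]
      exact @MeasurableSet.iInter _ _ (ℱ n) _ _ fun k => ℱ.mono (by omega) _ (hA k (b k))
    exact Measurable.comp (measurable_from_top) hh
  · exact (Set.finite_range (fun b => H (ext b))).subset (Set.range_comp_subset_range _ _)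

/-! ### Gaussian mixtures. -/

/-- Needed for a minorant `f` that takes negative values: `1 + x` below `exp x`. Passing to the
positive part suffices, and no integrability of `g` is required. -/
theorem ofReal_integral_le_lintegral_of_le {α : Type*} [MeasurableSpace α] {ν : Measure α}
    {f g : α → ℝ} (hf : Integrable f ν) (hfg : ∀ x, f x ≤ g x) :
    ENNReal.ofReal (∫ x, f x ∂ν) ≤ ∫⁻ x, ENNReal.ofReal (g x) ∂ν := by
  calc ENNReal.ofReal (∫ x, f x ∂ν) ≤ ENNReal.ofReal (∫ x, max (f x) 0 ∂ν) :=
        ENNReal.ofReal_le_ofReal (integral_mono hf hf.pos_part fun x => le_max_left _ _)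
    _ = ∫⁻ x, ENNReal.ofReal (max (f x) 0) ∂ν :=
        ofReal_integral_eq_lintegral_ofReal hf.pos_part
          (Filter.Eventually.of_forall fun x => le_max_right _ _)
    _ ≤ ∫⁻ x, ENNReal.ofReal (g x) ∂ν := by
        refine lintegral_mono fun x => ?_
        rcases le_total (f x) 0 with h | h
        · simp [h]
        · simpa [h] using ENNReal.ofReal_le_ofReal (hfg x)

theorem integrable_pow_mul_exp_neg_sq {b : ℝ} (hb : 0 < b) (n : ℕ) :
    Integrable (fun x : ℝ => x ^ n * Real.exp (-b * x ^ 2)) := by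
  have h := integrable_rpow_mul_exp_neg_mul_sq hb (s := n)
    (by have : (0 : ℝ) ≤ n := Nat.cast_nonneg n
        linarith)
  simpa only [Real.rpow_natCast] using h

theorem integral_id_mul_exp_neg_sq (b : ℝ) : ∫ x : ℝ, x ^ 1 * Real.exp (-b * x ^ 2) = 0 := by
  have h := integral_neg_eq_self (fun x : ℝ => x ^ 1 * Real.exp (-b * x ^ 2)) volume
  simp only [pow_one, even_two, Even.neg_pow, neg_mul, integral_neg] at h ⊢
  linarith

theorem integrable_monomial_mul_exp_neg_sq {q : Fin d → ℝ} (hq : ∀ i, 0 < q i) (e : Fin d → ℕ) :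
    Integrable (fun g : Fin d → ℝ => ∏ i, g i ^ e i * Real.exp (-(q i / 2) * g i ^ 2)) :=
  Integrable.fintype_prod (f := fun i x => x ^ e i * Real.exp (-(q i / 2) * x ^ 2))
    fun i => integrable_pow_mul_exp_neg_sq (half_pos (hq i)) (e i)

/-- By Fubini the coordinate `k` contributes the integral of an odd function. Linear monomials and
products of two distinct coordinates both have such a `k`. -/
theorem integral_monomial_mul_exp_neg_sq_eq_zero (q : Fin d → ℝ) (e : Fin d → ℕ) {k : Fin d}
    (hk : e k = 1) :
    ∫ g : Fin d → ℝ, ∏ i, g i ^ e i * Real.exp (-(q i / 2) * g i ^ 2) = 0 := by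
  rw [integral_fintype_prod_volume_eq_prod
    (f := fun i x => x ^ e i * Real.exp (-(q i / 2) * x ^ 2))]
  refine Finset.prod_eq_zero (Finset.mem_univ k) ?_
  rw [hk]
  exact integral_id_mul_exp_neg_sq _

theorem integral_prod_exp_neg_sq (q : Fin d → ℝ) :
    ∫ g : Fin d → ℝ, ∏ i, Real.exp (-(q i / 2) * g i ^ 2) =
      ∏ i, Real.sqrt (Real.pi / (q i / 2)) := by
  rw [integral_fintype_prod_volume_eq_prod (f := fun i x => Real.exp (-(q i / 2) * x ^ 2))]
  exact Finset.prod_congr rfl fun i _ => integral_gaussian _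

/-- The density of the centered Gaussian vector with independent coordinates of precisions `p`. -/
def gaussDensity (p u : Fin d → ℝ) : ℝ :=
  ∏ i, (Real.sqrt (p i / (2 * Real.pi)) * Real.exp (-(p i / 2) * u i ^ 2))

theorem gaussDensity_nonneg (p u : Fin d → ℝ) : 0 ≤ gaussDensity p u :=
  Finset.prod_nonneg fun _ _ => by positivity

theorem measurable_gaussDensity (p : Fin d → ℝ) : Measurable (gaussDensity p) := by
  unfold gaussDensity
  fun_prop

theorem lintegral_gaussDensity {p : Fin d → ℝ} (hp : ∀ i, 0 < p i) :
    ∫⁻ u, ENNReal.ofReal (gaussDensity p u) = 1 := by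
  have hi : Integrable (gaussDensity p) := by
    refine Integrable.fintype_prod
      (f := fun i x => Real.sqrt (p i / (2 * Real.pi)) * Real.exp (-(p i / 2) * x ^ 2)) fun i => ?_
    exact (integrable_exp_neg_mul_sq (half_pos (hp i))).const_mul _
  rw [← ofReal_integral_eq_lintegral_ofReal hi
    (Filter.Eventually.of_forall (gaussDensity_nonneg p))]
  unfold gaussDensity
  simp_rw [Finset.prod_mul_distrib]
  rw [integral_const_mul, integral_prod_exp_neg_sq, ← Finset.prod_mul_distrib]
  rw [Finset.prod_eq_one, ENNReal.ofReal_one]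
  intro i _
  have := hp i
  rw [← Real.sqrt_mul (by positivity)]
  have : p i / (2 * Real.pi) * (Real.pi / (p i / 2)) = 1 := by field_simp
  rw [this, Real.sqrt_one]

/-- A quadratic form without diagonal part, plus a linear form, has mean zero under a Gaussian
vector with independent coordinates. -/
theorem integral_one_add_linear_add_offDiag {q : Fin d → ℝ} (hq : ∀ i, 0 < q i) (l : Fin d → ℝ)
    (V : Fin d → Fin d → ℝ) :
    Integrable (fun g : Fin d → ℝ =>
      (1 + (∑ i, l i * g i - 1 / 2 * ∑ i, ∑ j ∈ Finset.univ.erase i, V i j * g i * g j)) *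
        ∏ i, Real.exp (-(q i / 2) * g i ^ 2)) ∧
    ∫ g : Fin d → ℝ,
      (1 + (∑ i, l i * g i - 1 / 2 * ∑ i, ∑ j ∈ Finset.univ.erase i, V i j * g i * g j)) *
        ∏ i, Real.exp (-(q i / 2) * g i ^ 2) = ∏ i, Real.sqrt (Real.pi / (q i / 2)) := by
  set G : (Fin d → ℝ) → ℝ := fun g => ∏ i, Real.exp (-(q i / 2) * g i ^ 2) with hG
  have h0 : Integrable G := by
    simpa [hG] using integrable_monomial_mul_exp_neg_sq hq 0
  have e1 : ∀ i, (fun g : Fin d → ℝ => g i * G g) =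
      fun g => ∏ k, g k ^ (Pi.single i 1 : Fin d → ℕ) k * Real.exp (-(q k / 2) * g k ^ 2) := by
    intro i
    funext g
    rw [Finset.prod_mul_distrib]
    congr 1
    rw [Finset.prod_eq_single i] <;> simp +contextual
  have h1 : ∀ i, Integrable (fun g => g i * G g) := fun i => by
    rw [e1 i]; exact integrable_monomial_mul_exp_neg_sq hq _
  have z1 : ∀ i, ∫ g, g i * G g = 0 := fun i => by
    rw [e1 i]; exact integral_monomial_mul_exp_neg_sq_eq_zero q _ (k := i) (by simp)
  have e2 : ∀ i j, (fun g : Fin d → ℝ => g i * g j * G g) =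
      fun g => ∏ k, g k ^ (Pi.single i 1 + Pi.single j 1 : Fin d → ℕ) k *
        Real.exp (-(q k / 2) * g k ^ 2) := by
    intro i j
    funext g
    rw [Finset.prod_mul_distrib]
    congr 1
    simp only [Pi.add_apply, pow_add, Finset.prod_mul_distrib]
    congr 1
    · rw [Finset.prod_eq_single i] <;> simp +contextual
    · rw [Finset.prod_eq_single j] <;> simp +contextual
  have h2 : ∀ i j, Integrable (fun g => g i * g j * G g) := fun i j => by
    rw [e2 i j]; exact integrable_monomial_mul_exp_neg_sq hq _
  have z2 : ∀ i j, j ≠ i → ∫ g, g i * g j * G g = 0 := fun i j hij => by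
    rw [e2 i j]
    exact integral_monomial_mul_exp_neg_sq_eq_zero q _ (k := i) (by simp [hij])
  have e : (fun g => (1 + (∑ i, l i * g i - 1 / 2 * ∑ i, ∑ j ∈ Finset.univ.erase i,
      V i j * g i * g j)) * G g) = fun g => G g + (∑ i, l i * (g i * G g) -
      ∑ i, ∑ j ∈ Finset.univ.erase i, (1 / 2 * V i j) * (g i * g j * G g)) := by
    funext g
    simp only [add_mul, sub_mul, one_mul, Finset.sum_mul, Finset.mul_sum]
    congr 2
    · exact Finset.sum_congr rfl fun i _ => by ring
    · exact Finset.sum_congr rfl fun i _ => Finset.sum_congr rfl fun j _ => by ring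
  have i1 : Integrable (fun g => ∑ i, l i * (g i * G g)) :=
    integrable_finsetSum _ fun i _ => (h1 i).const_mul _
  have i2 : ∀ i, Integrable (fun g => ∑ j ∈ Finset.univ.erase i,
      (1 / 2 * V i j) * (g i * g j * G g)) :=
    fun i => integrable_finsetSum _ fun j _ => (h2 i j).const_mul _
  have i3 : Integrable (fun g => ∑ i, ∑ j ∈ Finset.univ.erase i,
      (1 / 2 * V i j) * (g i * g j * G g)) :=
    integrable_finsetSum _ fun i _ => i2 i
  refine ⟨?_, ?_⟩
  · change Integrable (fun g => (1 + (∑ i, l i * g i - 1 / 2 * ∑ i, ∑ j ∈ Finset.univ.erase i,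
      V i j * g i * g j)) * G g)
    rw [e]
    exact h0.add (i1.sub i3)
  · change ∫ g, (fun g => (1 + (∑ i, l i * g i - 1 / 2 * ∑ i, ∑ j ∈ Finset.univ.erase i,
      V i j * g i * g j)) * G g) g = _
    have i4 : Integrable (fun g => ∑ i, l i * (g i * G g) -
        ∑ i, ∑ j ∈ Finset.univ.erase i, (1 / 2 * V i j) * (g i * g j * G g)) := i1.sub i3
    rw [e, integral_add h0 i4, integral_sub i1 i3, hG, integral_prod_exp_neg_sq,
      integral_finsetSum _ (fun i _ => (h1 i).const_mul _), integral_finsetSum _ (fun i _ => i2 i)]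
    have a1 : ∑ i, ∫ g, l i * (g i * G g) = 0 :=
      Finset.sum_eq_zero fun i _ => by rw [integral_const_mul, z1, mul_zero]
    have a2 : ∑ i, ∫ g, ∑ j ∈ Finset.univ.erase i, (1 / 2 * V i j) * (g i * g j * G g) = 0 := by
      refine Finset.sum_eq_zero fun i _ => ?_
      rw [integral_finsetSum _ (fun j _ => (h2 i j).const_mul _)]
      refine Finset.sum_eq_zero fun j hj => ?_
      rw [integral_const_mul, z2 i j (Finset.ne_of_mem_erase hj), mul_zero]
    rw [a1, a2]
    ring

/-- A lower bound for Gaussian mixtures of exponentials of quadratic polynomials. -/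
theorem le_lintegral_exp_mul_gaussDensity {p : Fin d → ℝ} (hp : ∀ i, 0 < p i)
    (V : Fin d → Fin d → ℝ) (hV : ∀ i, 0 ≤ V i i) (S w : Fin d → ℝ) :
    ENNReal.ofReal (Real.exp (∑ i, w i * S i - 1 / 2 * (∑ i, ∑ j, V i j * w i * w j)
        - 1 / 2 * ∑ i, p i * w i ^ 2) * ∏ i, Real.sqrt (p i / (p i + V i i))) ≤
      ∫⁻ u, ENNReal.ofReal (Real.exp (∑ i, u i * S i - 1 / 2 * (∑ i, ∑ j, V i j * u i * u j)) *
        gaussDensity p u) := by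
  -- The diagonal of `V` is absorbed into the precisions of the Gaussian.
  set q : Fin d → ℝ := fun i => p i + V i i with hq
  have hqp : ∀ i, 0 < q i := fun i => add_pos_of_pos_of_nonneg (hp i) (hV i)
  set l : Fin d → ℝ := fun i => S i - p i * w i - 1 / 2 * ∑ j, (V i j + V j i) * w j with hl
  obtain ⟨hi, hI⟩ := integral_one_add_linear_add_offDiag hqp l V
  set c : ℝ := Real.exp (∑ i, w i * S i - 1 / 2 * (∑ i, ∑ j, V i j * w i * w j)
        - 1 / 2 * ∑ i, p i * w i ^ 2) * ∏ i, Real.sqrt (p i / (2 * Real.pi)) with hc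
  have hc0 : 0 ≤ c := by positivity
  -- After recentring at `w`, the integrand is a constant times `exp` (linear minus off-diagonal
  -- quadratic) times a Gaussian of precisions `q`. With `exp x ≥ 1 + x` both parts have mean zero,
  -- so only a product over the diagonal remains, and no determinant of `V` is involved.
  rw [← lintegral_add_left_eq_self _ w]
  refine le_trans (le_of_eq ?_)
    (ofReal_integral_le_lintegral_of_le (hi.const_mul c) fun g => ?_)
  · rw [integral_const_mul, hI, hc, mul_assoc, ← Finset.prod_mul_distrib]
    congr 2
    refine Finset.prod_congr rfl fun i _ => ?_
    have h1 := hp i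
    have h2 := hqp i
    rw [← Real.sqrt_mul (by positivity)]
    congr 1
    change p i / q i = _
    field_simp
  · have key : Real.exp (∑ i, (w + g) i * S i - 1 / 2 * (∑ i, ∑ j, V i j * (w + g) i * (w + g) j))
        * gaussDensity p (w + g) = c * (Real.exp (∑ i, l i * g i - 1 / 2 * ∑ i,
          ∑ j ∈ Finset.univ.erase i, V i j * g i * g j) *
            ∏ i, Real.exp (-(q i / 2) * g i ^ 2)) := by
      unfold gaussDensity
      rw [Finset.prod_mul_distrib, hc, ← Real.exp_sum, ← Real.exp_sum, ← Real.exp_add,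
        mul_comm (Real.exp _) (∏ i, Real.sqrt _), mul_assoc, ← Real.exp_add, mul_left_comm,
        ← Real.exp_add]
      congr 2
      have hsplit : ∀ i, ∑ j ∈ Finset.univ.erase i, V i j * g i * g j =
          ∑ j, V i j * g i * g j - V i i * g i * g i := fun i => by
        rw [← Finset.add_sum_erase Finset.univ _ (Finset.mem_univ i)]; ring
      have hlin : ∑ i, l i * g i = ∑ i, S i * g i - ∑ i, p i * w i * g i -
          1 / 2 * ((∑ i, ∑ j, V i j * g i * w j) + ∑ i, ∑ j, V i j * w i * g j) := by
        rw [Finset.sum_comm (f := fun i j => V i j * w i * g j), ← Finset.sum_add_distrib,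
          Finset.mul_sum, ← Finset.sum_sub_distrib, ← Finset.sum_sub_distrib]
        refine Finset.sum_congr rfl fun i _ => ?_
        rw [← Finset.sum_add_distrib, hl]
        simp only [sub_mul, mul_assoc, Finset.sum_mul]
        congr 2
        refine Finset.sum_congr rfl fun j _ => by ring
      have hquad : ∑ i, ∑ j, V i j * (w + g) i * (w + g) j = ∑ i, ∑ j, V i j * w i * w j +
          ((∑ i, ∑ j, V i j * g i * w j) + ∑ i, ∑ j, V i j * w i * g j) +
          ∑ i, ∑ j, V i j * g i * g j := by
        simp only [← Finset.sum_add_distrib]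
        refine Finset.sum_congr rfl fun i _ => Finset.sum_congr rfl fun j _ => ?_
        simp only [Pi.add_apply]
        ring
      have hp2 : ∑ i, -(p i / 2) * (w + g) i ^ 2 = - (1 / 2 * ∑ i, p i * w i ^ 2) -
          ∑ i, p i * w i * g i + ∑ i, -(p i / 2) * g i ^ 2 := by
        rw [Finset.mul_sum, ← Finset.sum_neg_distrib, ← Finset.sum_sub_distrib,
          ← Finset.sum_add_distrib]
        refine Finset.sum_congr rfl fun i _ => ?_
        simp only [Pi.add_apply]
        ring
      have hq2 : ∑ i, -(q i / 2) * g i ^ 2 = ∑ i, -(p i / 2) * g i ^ 2 -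
          1 / 2 * ∑ i, V i i * g i * g i := by
        rw [Finset.mul_sum, ← Finset.sum_sub_distrib]
        refine Finset.sum_congr rfl fun i _ => ?_
        simp only [hq]
        ring
      have hS : ∑ i, (w + g) i * S i = ∑ i, w i * S i + ∑ i, S i * g i := by
        rw [← Finset.sum_add_distrib]
        refine Finset.sum_congr rfl fun i _ => ?_
        simp only [Pi.add_apply]
        ring
      rw [hlin, hquad, hp2, hq2, hS, Finset.sum_congr rfl fun i _ => hsplit i,
        Finset.sum_sub_distrib]
      ring
    rw [key]
    refine mul_le_mul_of_nonneg_left ?_ hc0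
    refine mul_le_mul_of_nonneg_right ?_ (Finset.prod_nonneg fun _ _ => (Real.exp_pos _).le)
    rw [add_comm]
    exact Real.add_one_le_exp _

/-! ### Self-normalized deviations of the accumulated noise. -/

/-- The accumulated noise of the arms of `B` before stage `t`. -/
def noiseSum (B : Finset (Fin d)) (μ : Fin d → ℝ) (a : ℕ → Finset (Fin d)) (x : ℕ → Fin d → ℝ)
    (t : ℕ) (i : Fin d) : ℝ :=
  ∑ s ∈ Finset.Ico 1 t, if i ∈ a s ∩ B then x s i - μ i else 0

/-- The accumulated covariance of the arms of `B` before stage `t`. -/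
def covSum (B : Finset (Fin d)) (C : Matrix (Fin d) (Fin d) ℝ) (a : ℕ → Finset (Fin d))
    (t : ℕ) (i j : Fin d) : ℝ :=
  ∑ s ∈ Finset.Ico 1 t, if i ∈ a s ∩ B ∧ j ∈ a s ∩ B then C i j else 0

/-- The restriction of a vector to a set of arms. -/
def restr (D : Finset (Fin d)) (u : Fin d → ℝ) : Fin d → ℝ := fun i => if i ∈ D then u i else 0

theorem sum_restr_dotProduct (B : Finset (Fin d)) (μ : Fin d → ℝ) (a : ℕ → Finset (Fin d))
    (x : ℕ → Fin d → ℝ) (t : ℕ) (u : Fin d → ℝ) :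
    ∑ s ∈ Finset.Ico 1 t, restr (a s ∩ B) u ⬝ᵥ (x s - μ) = ∑ i, u i * noiseSum B μ a x t i := by
  simp only [noiseSum, Finset.mul_sum, dotProduct]
  rw [Finset.sum_comm]
  refine Finset.sum_congr rfl fun i _ => Finset.sum_congr rfl fun s _ => ?_
  by_cases h : i ∈ a s ∩ B <;> simp only [restr, if_true, if_false, h, Pi.sub_apply, zero_mul,
    mul_zero]

theorem sum_restr_quadratic (B : Finset (Fin d)) (C : Matrix (Fin d) (Fin d) ℝ)
    (a : ℕ → Finset (Fin d)) (t : ℕ) (u : Fin d → ℝ) :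
    ∑ s ∈ Finset.Ico 1 t, restr (a s ∩ B) u ⬝ᵥ (C *ᵥ restr (a s ∩ B) u) =
      ∑ i, ∑ j, covSum B C a t i j * u i * u j := by
  simp only [covSum, Finset.sum_mul, dotProduct, Matrix.mulVec, Finset.mul_sum]
  rw [Finset.sum_comm]
  refine Finset.sum_congr rfl fun i _ => ?_
  rw [Finset.sum_comm]
  refine Finset.sum_congr rfl fun j _ => Finset.sum_congr rfl fun s _ => ?_
  by_cases hi : i ∈ a s ∩ B <;> by_cases hj : j ∈ a s ∩ B <;>
    simp only [restr, if_true, if_false, hi, hj, and_self, and_false, false_and, mul_zero, zero_mul]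
  ring

section Probability

variable [mΩ : MeasurableSpace Ω] {P : Measure Ω} {ℱ : Filtration ℕ mΩ}
  {X : ℕ → Ω → Fin d → ℝ} {μ : Fin d → ℝ} {C : Matrix (Fin d) (Fin d) ℝ}
  {A : ℕ → Ω → Finset (Fin d)}

theorem measurable_noiseSum (hX : IsRewardProcess P ℱ X μ C)
    (hA : ∀ t B, MeasurableSet[ℱ t] {ω | A (t + 1) ω = B}) (B : Finset (Fin d)) (t : ℕ)
    (i : Fin d) :
    Measurable (fun ω => noiseSum B μ (fun s => A s ω) (fun s => X s ω) t i) := by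
  unfold noiseSum
  refine Finset.measurable_sum _ fun s hs => ?_
  obtain ⟨k, rfl⟩ : ∃ k, s = k + 1 := ⟨s - 1, by have := (Finset.mem_Ico.1 hs).1; omega⟩
  have h1 : Measurable (X (k + 1)) := (hX.adapted k).mono (ℱ.le _) le_rfl
  have h2 := ((measurable_of_actions (β := Prop) hA (n := k) (H := fun a => i ∈ a (k + 1) ∩ B)
    (fun a b h => by simp only [h (k + 1) (by simp)])).1).mono (ℱ.le _) le_rfl
  refine Measurable.ite (measurableSet_setOfPred.2 h2) ?_ measurable_const
  fun_prop

theorem measurable_covSum (hA : ∀ t B, MeasurableSet[ℱ t] {ω | A (t + 1) ω = B})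
    (B : Finset (Fin d)) (t : ℕ) (i j : Fin d) :
    Measurable (fun ω => covSum B C (fun s => A s ω) t i j) := by
  refine ((measurable_of_actions hA (n := t) (H := fun a => covSum B C a t i j)
    (fun a b h => ?_)).1).mono (ℱ.le _) le_rfl
  refine Finset.sum_congr rfl fun s hs => ?_
  rw [h s (by simp only [Finset.mem_Ico, Finset.mem_Icc] at *; omega)]

/-- The Gaussian mixture of the exponential supermartingales of the arms of `B`. -/
def mixture (B : Finset (Fin d)) (μ : Fin d → ℝ) (C : Matrix (Fin d) (Fin d) ℝ)
    (X : ℕ → Ω → Fin d → ℝ) (A : ℕ → Ω → Finset (Fin d)) (p : Fin d → ℝ) (t : ℕ) (ω : Ω) :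
    ENNReal :=
  ∫⁻ u, ENNReal.ofReal (Real.exp (∑ i, u i * noiseSum B μ (fun s => A s ω) (fun s => X s ω) t i
      - 1 / 2 * (∑ i, ∑ j, covSum B C (fun s => A s ω) t i j * u i * u j)) * gaussDensity p u)

theorem measurable_mixture_integrand (hX : IsRewardProcess P ℱ X μ C)
    (hA : ∀ t B, MeasurableSet[ℱ t] {ω | A (t + 1) ω = B}) (B : Finset (Fin d)) (p : Fin d → ℝ)
    (t : ℕ) :
    Measurable (fun z : Ω × (Fin d → ℝ) => ENNReal.ofReal (Real.exp (∑ i, z.2 i *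
      noiseSum B μ (fun s => A s z.1) (fun s => X s z.1) t i
      - 1 / 2 * (∑ i, ∑ j, covSum B C (fun s => A s z.1) t i j * z.2 i * z.2 j)) *
        gaussDensity p z.2)) := by
  have h1 : ∀ i, Measurable (fun z : Ω × (Fin d → ℝ) =>
      noiseSum B μ (fun s => A s z.1) (fun s => X s z.1) t i) := fun i =>
    (measurable_noiseSum hX hA B t i).comp measurable_fst
  have h2 : ∀ i j, Measurable (fun z : Ω × (Fin d → ℝ) =>
      covSum B C (fun s => A s z.1) t i j) := fun i j =>
    (measurable_covSum hA B t i j).comp measurable_fst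
  have h3 : Measurable (fun z : Ω × (Fin d → ℝ) => gaussDensity p z.2) :=
    (measurable_gaussDensity p).comp measurable_snd
  fun_prop

theorem measurable_mixture (hX : IsRewardProcess P ℱ X μ C)
    (hA : ∀ t B, MeasurableSet[ℱ t] {ω | A (t + 1) ω = B}) (B : Finset (Fin d)) (p : Fin d → ℝ)
    (t : ℕ) : Measurable (mixture B μ C X A p t) :=
  (measurable_mixture_integrand hX hA B p t).lintegral_prod_right'

variable [IsProbabilityMeasure P]

/-- Tonelli: for fixed `u` the integrand is a compensated exponential with predictable direction
`restr (A s ω ∩ B) u`. -/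
theorem lintegral_mixture_le_one (hX : IsRewardProcess P ℱ X μ C)
    (hA : ∀ t B, MeasurableSet[ℱ t] {ω | A (t + 1) ω = B}) (B : Finset (Fin d)) {p : Fin d → ℝ}
    (hp : ∀ i, 0 < p i) (n : ℕ) : ∫⁻ ω, mixture B μ C X A p (n + 1) ω ∂P ≤ 1 := by
  unfold mixture
  rw [lintegral_lintegral_swap (measurable_mixture_integrand hX hA B p (n + 1)).aemeasurable,
    ← lintegral_gaussDensity hp]
  refine lintegral_mono fun u => ?_
  have hU := fun t => measurable_of_actions (β := Fin d → ℝ) hA (n := t)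
    (H := fun a => restr (a (t + 1) ∩ B) u) (fun a b h => by simp only [h (t + 1) (by simp)])
  have key := lintegral_exp_compensated_le_one hX (U := fun s ω => restr (A s ω ∩ B) u)
    (fun t => (hU t).1) (fun t => (hU t).2) n
  have e : ∀ ω, ENNReal.ofReal (Real.exp (∑ i, u i *
      noiseSum B μ (fun s => A s ω) (fun s => X s ω) (n + 1) i
      - 1 / 2 * (∑ i, ∑ j, covSum B C (fun s => A s ω) (n + 1) i j * u i * u j)) *
        gaussDensity p u) = ENNReal.ofReal (Real.exp (∑ s ∈ Finset.Ico 1 (n + 1),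
      (restr (A s ω ∩ B) u ⬝ᵥ (X s ω - μ) -
        1 / 2 * (restr (A s ω ∩ B) u ⬝ᵥ (C *ᵥ restr (A s ω ∩ B) u))))) *
      ENNReal.ofReal (gaussDensity p u) := by
    intro ω
    rw [ENNReal.ofReal_mul (Real.exp_nonneg _), Finset.sum_sub_distrib, ← Finset.mul_sum,
      sum_restr_dotProduct B μ (fun s => A s ω) (fun s => X s ω),
      sum_restr_quadratic B C (fun s => A s ω)]
  simp_rw [e]
  rw [lintegral_mul_const' _ _ ENNReal.ofReal_ne_top]
  exact mul_le_of_le_one_left' key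

/-- A self-normalized deviation bound for the accumulated noise, uniform in the direction. -/
theorem measure_self_normalized_le (hX : IsRewardProcess P ℱ X μ C)
    (hA : ∀ t B, MeasurableSet[ℱ t] {ω | A (t + 1) ω = B}) (B : Finset (Fin d)) {p κ : Fin d → ℝ}
    (hp : ∀ i, 0 < p i) (hκ : ∀ i, 0 ≤ κ i) (n : ℕ) (f : ℝ) :
    P {ω | (∀ i, covSum B C (fun s => A s ω) (n + 1) i i ≤ κ i * p i) ∧ ∃ v : Fin d → ℝ,
      0 < ∑ i, p i * v i ^ 2 + ∑ i, ∑ j, covSum B C (fun s => A s ω) (n + 1) i j * v i * v j ∧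
      2 * f * (∑ i, p i * v i ^ 2 +
        ∑ i, ∑ j, covSum B C (fun s => A s ω) (n + 1) i j * v i * v j) <
      (∑ i, v i * noiseSum B μ (fun s => A s ω) (fun s => X s ω) (n + 1) i) ^ 2} ≤
    ENNReal.ofReal (Real.exp (-f) * ∏ i, Real.sqrt (1 + κ i)) := by
  -- The event forces the mixture to be at least `1 / c`, and Markov's inequality concludes. The
  -- mixture does not depend on `v`, which makes the bound uniform in the direction.
  set c : ℝ := Real.exp (-f) * ∏ i, Real.sqrt (1 + κ i) with hc
  have hprod : 0 < ∏ i, Real.sqrt (1 + κ i) :=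
    Finset.prod_pos fun i _ => Real.sqrt_pos.2 (by linarith [hκ i])
  have hcpos : 0 < c := by positivity
  have hsub : {ω | (∀ i, covSum B C (fun s => A s ω) (n + 1) i i ≤ κ i * p i) ∧
      ∃ v : Fin d → ℝ,
      0 < ∑ i, p i * v i ^ 2 + ∑ i, ∑ j, covSum B C (fun s => A s ω) (n + 1) i j * v i * v j ∧
      2 * f * (∑ i, p i * v i ^ 2 +
        ∑ i, ∑ j, covSum B C (fun s => A s ω) (n + 1) i j * v i * v j) <
      (∑ i, v i * noiseSum B μ (fun s => A s ω) (fun s => X s ω) (n + 1) i) ^ 2} ⊆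
      {ω | (ENNReal.ofReal c)⁻¹ ≤ mixture B μ C X A p (n + 1) ω} := by
    rintro ω ⟨hV, v, hv0, hv⟩
    set V := covSum B C (fun s => A s ω) (n + 1) with hVdef
    set S := noiseSum B μ (fun s => A s ω) (fun s => X s ω) (n + 1) with hS
    set Q := ∑ i, p i * v i ^ 2 + ∑ i, ∑ j, V i j * v i * v j with hQ
    have hVnn : ∀ i, 0 ≤ V i i := by
      intro i
      refine Finset.sum_nonneg fun s _ => ?_
      split_ifs
      · exact hX.posSemidef.diag_nonneg
      · exact le_rfl
    set y := ∑ i, v i * S i with hy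
    -- Along `v` the exponent at `s • v` is `s * y - s² * Q / 2`; the choice `s = y / Q` maximizes
    -- it, with value `y² / (2 Q)`, which exceeds `f`.
    have low := le_lintegral_exp_mul_gaussDensity hp V hVnn S (fun i => y / Q * v i)
    refine le_trans ?_ low
    rw [← ENNReal.ofReal_inv_of_pos hcpos]
    refine ENNReal.ofReal_le_ofReal ?_
    have e1 : ∑ i, y / Q * v i * S i - 1 / 2 * (∑ i, ∑ j, V i j * (y / Q * v i) * (y / Q * v j))
        - 1 / 2 * ∑ i, p i * (y / Q * v i) ^ 2 = y ^ 2 / (2 * Q) := by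
      have a1 : ∑ i, y / Q * v i * S i = y / Q * y := by
        conv_rhs => rw [hy, Finset.mul_sum]
        exact Finset.sum_congr rfl fun i _ => by ring
      have a2 : ∑ i, ∑ j, V i j * (y / Q * v i) * (y / Q * v j) =
          (y / Q) ^ 2 * ∑ i, ∑ j, V i j * v i * v j := by
        simp only [Finset.mul_sum]
        exact Finset.sum_congr rfl fun i _ => Finset.sum_congr rfl fun j _ => by ring
      have a3 : ∑ i, p i * (y / Q * v i) ^ 2 = (y / Q) ^ 2 * ∑ i, p i * v i ^ 2 := by
        simp only [Finset.mul_sum]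
        exact Finset.sum_congr rfl fun i _ => by ring
      rw [a1, a2, a3]
      have : y / Q * y - 1 / 2 * ((y / Q) ^ 2 * ∑ i, ∑ j, V i j * v i * v j) -
          1 / 2 * ((y / Q) ^ 2 * ∑ i, p i * v i ^ 2) = y / Q * y - 1 / 2 * ((y / Q) ^ 2 * Q) := by
        rw [hQ]; ring
      rw [this]
      field_simp
      ring
    rw [e1, hc, mul_inv, ← Real.exp_neg, neg_neg, ← Finset.prod_inv_distrib]
    refine mul_le_mul ?_ ?_ (Finset.prod_nonneg fun i _ => by positivity) (Real.exp_nonneg _)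
    · refine Real.exp_le_exp.2 ?_
      rw [le_div_iff₀ (by positivity)]
      linarith
    -- `V i i ≤ κ i * p i` replaces the random normalization `p / (p + V)` by the deterministic `1 /
    -- (1 + κ)`.
    · refine Finset.prod_le_prod (fun i _ => by positivity) fun i _ => ?_
      rw [← Real.sqrt_inv]
      refine Real.sqrt_le_sqrt ?_
      have h1 := hp i
      have h2 := hV i
      have h3 := hVnn i
      have h4 := hκ i
      rw [inv_eq_one_div, div_le_div_iff₀ (by linarith) (by linarith)]
      nlinarith
  refine (measure_mono hsub).trans ?_
  have hm := mul_meas_ge_le_lintegral₀ (μ := P)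
    (measurable_mixture hX hA B p (n + 1)).aemeasurable (ENNReal.ofReal c)⁻¹
  have h1 := hm.trans (lintegral_mixture_le_one hX hA B hp n)
  have hc1 : ENNReal.ofReal c ≠ 0 := by simpa using hcpos
  calc _ = ENNReal.ofReal c * ((ENNReal.ofReal c)⁻¹ *
          P {ω | (ENNReal.ofReal c)⁻¹ ≤ mixture B μ C X A p (n + 1) ω}) := by
        rw [← mul_assoc, ENNReal.mul_inv_cancel hc1 ENNReal.ofReal_ne_top, one_mul]
    _ ≤ ENNReal.ofReal c * 1 := by gcongr
    _ = _ := mul_one _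

end Probability

/-! ### Confidence widths and the exploration function. -/

/-- The squared width of the confidence interval of the mean reward of `A`, up to `2 f(t)`. -/
def widthSq (Γ : Matrix (Fin d) (Fin d) ℝ) (lam : ℝ) (a : ℕ → Finset (Fin d)) (t : ℕ)
    (A : Finset (Fin d)) : ℝ :=
  lam * ∑ i ∈ A, Γ i i / (pulls a t i : ℝ) +
    ∑ i, ∑ j, covSum A Γ a t i j * (pulls a t i : ℝ)⁻¹ * (pulls a t j : ℝ)⁻¹

theorem design_eq_diagonal (a : ℕ → Finset (Fin d)) (t : ℕ) :
    design a t = Matrix.diagonal (fun i => (pulls a t i : ℝ)) := by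
  ext i j
  by_cases h : i = j
  · subst h
    simp [design, Matrix.sum_apply, proj, vec, pulls]
  · simp [design, Matrix.sum_apply, proj, h]

theorem bonus_eq (Γ : Matrix (Fin d) (Fin d) ℝ) (lam : ℝ) {a : ℕ → Finset (Fin d)} {t : ℕ}
    (hN : ∀ i, pulls a t i ≠ 0) (A : Finset (Fin d)) :
    bonus m Γ lam a t A =
      Real.sqrt (2 * explore m lam t) * Real.sqrt (widthSq Γ lam a t A) := by
  have hinv : (design a t)⁻¹ = Matrix.diagonal (fun i => (pulls a t i : ℝ)⁻¹) := by
    refine Matrix.inv_eq_right_inv ?_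
    rw [design_eq_diagonal, Matrix.diagonal_mul_diagonal, ← Matrix.diagonal_one]
    congr 1
    funext i
    have : (pulls a t i : ℝ) ≠ 0 := by exact_mod_cast hN i
    field_simp
  unfold bonus widthSq
  rw [hinv]
  congr 2
  rw [design_eq_diagonal, Matrix.diagonal_mul_diagonal]
  have e1 : ∑ i ∈ A, Γ i i / (pulls a t i : ℝ) =
      ∑ i, ∑ j, (if i = j then vec A i * (Γ i i / (pulls a t i : ℝ)) else 0) := by
    simp [vec]
  rw [e1, Finset.mul_sum, ← Finset.sum_add_distrib, dotProduct]
  refine Finset.sum_congr rfl fun i _ => ?_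
  rw [Matrix.mulVec, dotProduct, Finset.mul_sum, Finset.mul_sum, ← Finset.sum_add_distrib]
  refine Finset.sum_congr rfl fun j _ => ?_
  rw [Matrix.mul_diagonal, Matrix.diagonal_mul, Matrix.add_apply, Matrix.smul_apply,
    Matrix.sum_apply, Matrix.diagonal_apply, covSum]
  have e2 : ∀ s, (proj (a s) * Γ * proj (a s)) i j = vec (a s) i * Γ i j * vec (a s) j := by
    intro s
    rw [proj, Matrix.mul_diagonal, Matrix.diagonal_mul]
  have e3 : ∑ s ∈ Finset.Ico 1 t, (if i ∈ a s ∩ A ∧ j ∈ a s ∩ A then Γ i j else 0) =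
      vec A i * vec A j * ∑ s ∈ Finset.Ico 1 t, vec (a s) i * Γ i j * vec (a s) j := by
    rw [Finset.mul_sum]
    refine Finset.sum_congr rfl fun s _ => ?_
    simp only [vec, Finset.mem_inter]
    by_cases h1 : i ∈ A <;> by_cases h2 : j ∈ A <;> by_cases h3 : i ∈ a s <;>
      by_cases h4 : j ∈ a s <;> simp [h1, h2, h3, h4]
  rw [e3, Finset.sum_congr rfl fun s _ => e2 s]
  by_cases hij : i = j
  · subst hij
    have : (pulls a t i : ℝ) ≠ 0 := by exact_mod_cast hN i
    have hv : vec A i * vec A i = vec A i := by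
      simp only [vec]
      split_ifs <;> simp
    simp only [if_true, smul_eq_mul]
    calc _ = lam * ((vec A i * vec A i) * (Γ i i / (pulls a t i : ℝ))) + vec A i * vec A i *
            (∑ s ∈ Finset.Ico 1 t, vec (a s) i * Γ i i * vec (a s) i) *
              (pulls a t i : ℝ)⁻¹ * (pulls a t i : ℝ)⁻¹ := by
          field_simp
      _ = _ := by rw [hv]
  · simp only [hij, if_false, smul_zero, zero_add, mul_zero]
    ring

theorem covSum_self (B : Finset (Fin d)) (C : Matrix (Fin d) (Fin d) ℝ) (a : ℕ → Finset (Fin d))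
    (t : ℕ) (i : Fin d) :
    covSum B C a t i i = if i ∈ B then (pulls a t i : ℝ) * C i i else 0 := by
  unfold covSum pulls
  by_cases h : i ∈ B
  · simp [h, Finset.sum_ite]
  · simp [h]

theorem sum_muHat_sub (B : Finset (Fin d)) (μ : Fin d → ℝ) {a : ℕ → Finset (Fin d)}
    (x : ℕ → Fin d → ℝ) {t : ℕ} (hN : ∀ i, pulls a t i ≠ 0) :
    ∑ i ∈ B, muHat a x t i - meanReward μ B =
      ∑ i, restr B (fun i => (pulls a t i : ℝ)⁻¹) i * noiseSum B μ a x t i := by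
  have e : ∑ i, restr B (fun i => (pulls a t i : ℝ)⁻¹) i * noiseSum B μ a x t i =
      ∑ i ∈ B, (pulls a t i : ℝ)⁻¹ * noiseSum B μ a x t i := by
    simp [restr, ite_mul]
  rw [e, meanReward, ← Finset.sum_sub_distrib]
  refine Finset.sum_congr rfl fun i hi => ?_
  have h0 : (pulls a t i : ℝ) ≠ 0 := by exact_mod_cast hN i
  have e2 : noiseSum B μ a x t i =
      ∑ s ∈ (Finset.Ico 1 t).filter (fun s => i ∈ a s), x s i - pulls a t i * μ i := by
    simp [noiseSum, hi, Finset.sum_ite, pulls]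
  rw [e2, muHat]
  field_simp

/-- The vectors of interest vanish off an action, while `LePos` tests strictly positive vectors
only; shift all coordinates by `e > 0` and let `e → 0`. -/
theorem LePos.le_of_nonneg {C Γ : Matrix (Fin d) (Fin d) ℝ} (h : LePos C Γ) {v : Fin d → ℝ}
    (hv : ∀ i, 0 ≤ v i) : v ⬝ᵥ (C *ᵥ v) ≤ v ⬝ᵥ (Γ *ᵥ v) := by
  have hc : ∀ M : Matrix (Fin d) (Fin d) ℝ, Filter.Tendsto
      (fun e : ℝ => (fun i => v i + e) ⬝ᵥ (M *ᵥ fun i => v i + e)) (nhdsWithin 0 (Set.Ioi 0))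
      (nhds (v ⬝ᵥ (M *ᵥ v))) := by
    intro M
    have : Continuous (fun e : ℝ => (fun i => v i + e) ⬝ᵥ (M *ᵥ fun i => v i + e)) := by
      unfold Matrix.mulVec dotProduct
      fun_prop
    have h0 := this.tendsto 0
    simp only [add_zero] at h0
    exact h0.mono_left nhdsWithin_le_nhds
  refine le_of_tendsto_of_tendsto (hc C) (hc Γ) ?_
  filter_upwards [self_mem_nhdsWithin] with e he
  exact h _ fun i => add_pos_of_nonneg_of_pos (hv i) he

theorem LePos.diag_le {C Γ : Matrix (Fin d) (Fin d) ℝ} (h : LePos C Γ) (i : Fin d) :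
    C i i ≤ Γ i i := by
  have := h.le_of_nonneg (v := Pi.single i 1) fun j => by
    by_cases hj : j = i
    · subst hj; simp
    · simp [hj]
  simpa using this

theorem pulls_lt (a : ℕ → Finset (Fin d)) {t : ℕ} (ht : 1 ≤ t) (i : Fin d) : pulls a t i < t := by
  have := Finset.card_filter_le (Finset.Ico 1 t) (fun s => i ∈ a s)
  rw [Nat.card_Ico] at this
  unfold pulls
  omega

/-- The factors have separate uses: `log t ^ m` pays for the number of grid cells, the power of the
square root for the Gaussian normalization in a cell, and the remaining `t * log t ^ 2` is summable.
-/
theorem exp_neg_explore {lam : ℝ} (hlam : 0 < lam) {t : ℕ} (ht : 2 ≤ t) :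
    Real.exp (-explore m lam t) =
      (t * Real.log t ^ (m + 2) * Real.sqrt (1 + Real.exp 1 / lam) ^ m)⁻¹ := by
  have h0 : (0 : ℝ) < t := by positivity
  have hl : 0 < Real.log t := Real.log_pos (by exact_mod_cast ht)
  have hc : 0 < 1 + Real.exp 1 / lam := by positivity
  rw [Real.exp_neg, explore, Real.exp_add, Real.exp_add, Real.exp_log h0]
  congr 2
  · congr 1
    rw [← Real.exp_log (pow_pos hl (m + 2)), Real.log_pow]
    push_cast
    rfl
  · rw [← Real.exp_log (pow_pos (Real.sqrt_pos.2 hc) m), Real.log_pow, Real.log_sqrt hc.le]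
    congr 1
    ring

theorem explore_nonneg {lam : ℝ} (hlam : 0 < lam) {t : ℕ} (ht : 3 ≤ t) :
    0 ≤ explore m lam t := by
  have h3 : (3 : ℝ) ≤ t := by exact_mod_cast ht
  have hl : 1 ≤ Real.log t := by
    rw [Real.le_log_iff_exp_le (by linarith)]
    linarith [Real.exp_one_lt_d9]
  have h2 := Real.log_nonneg hl
  have h4 : 0 ≤ Real.log (1 + Real.exp 1 / lam) :=
    Real.log_nonneg (by have : 0 ≤ Real.exp 1 / lam := by positivity
                        linarith)
  unfold explore
  positivity

/-- The geometric grid of ratio `t ^ (1 / ⌊log t⌋)` costs no more than a grid of ratio `e`. -/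
theorem floor_log_mul_sqrt_le {lam : ℝ} (hlam : 0 < lam) {L : ℝ} (hL : 1 ≤ L) :
    (⌊L⌋₊ : ℝ) * Real.sqrt (1 + Real.exp (L / ⌊L⌋₊) / lam) ≤
      L * Real.sqrt (1 + Real.exp 1 / lam) := by
  have hK1 : 1 ≤ ⌊L⌋₊ := Nat.le_floor (by simpa using hL)
  have hK : (1 : ℝ) ≤ ⌊L⌋₊ := by exact_mod_cast hK1
  have hKL : (⌊L⌋₊ : ℝ) ≤ L := Nat.floor_le (by linarith)
  have hLK : L < ⌊L⌋₊ + 1 := Nat.lt_floor_add_one L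
  set K : ℝ := (⌊L⌋₊ : ℝ)
  -- With `y = L / K - 1 ∈ [0, 1]`, this is `exp y ≤ 1 + y + y² ≤ (1 + y)²`. The bound `y ≤ 1` comes
  -- from `L < K + 1 ≤ 2 K`.
  have hx : Real.exp (L / K) ≤ Real.exp 1 * (L / K) ^ 2 := by
    have e : L / K = 1 + (L / K - 1) := by ring
    set y := L / K - 1
    have hy0 : 0 ≤ y := by
      have : 1 ≤ L / K := by rw [le_div_iff₀ (by linarith)]; linarith
      linarith
    have hy1 : y ≤ 1 := by
      have : L / K ≤ 2 := by rw [div_le_iff₀ (by linarith)]; linarith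
      linarith
    rw [e, Real.exp_add]
    refine mul_le_mul_of_nonneg_left ?_ (Real.exp_nonneg _)
    have := (abs_le.1 (Real.abs_exp_sub_one_sub_id_le (x := y) (abs_le.2 ⟨by linarith, hy1⟩))).2
    nlinarith
  have e1 : K * Real.sqrt (1 + Real.exp (L / K) / lam) =
      Real.sqrt (K ^ 2 * (1 + Real.exp (L / K) / lam)) := by
    rw [Real.sqrt_mul (by positivity), Real.sqrt_sq (by linarith)]
  have e2 : L * Real.sqrt (1 + Real.exp 1 / lam) =
      Real.sqrt (L ^ 2 * (1 + Real.exp 1 / lam)) := by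
    rw [Real.sqrt_mul (by positivity), Real.sqrt_sq (by linarith)]
  rw [e1, e2]
  refine Real.sqrt_le_sqrt ?_
  have h1 : K ^ 2 * Real.exp (L / K) ≤ L ^ 2 * Real.exp 1 := by
    calc K ^ 2 * Real.exp (L / K) ≤ K ^ 2 * (Real.exp 1 * (L / K) ^ 2) := by gcongr
      _ = L ^ 2 * Real.exp 1 := by field_simp
  have h2 : K ^ 2 ≤ L ^ 2 := by gcongr
  calc K ^ 2 * (1 + Real.exp (L / K) / lam) = K ^ 2 + K ^ 2 * Real.exp (L / K) / lam := by ring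
    _ ≤ L ^ 2 + L ^ 2 * Real.exp 1 / lam := by gcongr
    _ = _ := by ring

theorem restr_inter_restr (D B : Finset (Fin d)) (v : Fin d → ℝ) :
    restr (D ∩ B) (restr B v) = restr (D ∩ B) v := by
  funext i
  by_cases h1 : i ∈ D <;> by_cases h2 : i ∈ B <;> simp [restr, h1, h2]

/-- For nonnegative directions the accumulated covariance is at most that of a `⪯₊`-majorant. -/
theorem sum_covSum_restr_le {C Γ : Matrix (Fin d) (Fin d) ℝ} (hCΓ : LePos C Γ)
    (B : Finset (Fin d)) (a : ℕ → Finset (Fin d)) (t : ℕ) {v : Fin d → ℝ} (hv : ∀ i, 0 ≤ v i) :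
    ∑ i, ∑ j, covSum B C a t i j * restr B v i * restr B v j ≤
      ∑ i, ∑ j, covSum B Γ a t i j * v i * v j := by
  rw [← sum_restr_quadratic, ← sum_restr_quadratic]
  refine Finset.sum_le_sum fun s _ => ?_
  rw [restr_inter_restr]
  refine hCΓ.le_of_nonneg fun i => ?_
  unfold restr
  split_ifs
  · exact hv i
  · exact le_rfl

theorem sum_covSum_nonneg {C : Matrix (Fin d) (Fin d) ℝ} (hC : C.PosSemidef)
    (B : Finset (Fin d)) (a : ℕ → Finset (Fin d)) (t : ℕ) (v : Fin d → ℝ) :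
    0 ≤ ∑ i, ∑ j, covSum B C a t i j * v i * v j := by
  rw [← sum_restr_quadratic]
  refine Finset.sum_nonneg fun s _ => ?_
  simpa using hC.dotProduct_mulVec_nonneg (restr (a s ∩ B) v)

/-! ### Optimism: peeling over the numbers of pulls. -/

section Probability

variable [mΩ : MeasurableSpace Ω] {P : Measure Ω} [IsProbabilityMeasure P] {ℱ : Filtration ℕ mΩ}
  {X : ℕ → Ω → Fin d → ℝ} {μ : Fin d → ℝ} {C Γ : Matrix (Fin d) (Fin d) ℝ}
  {A : ℕ → Ω → Finset (Fin d)}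

/-- Deviations of the estimated mean of `B`, while the numbers of pulls of its arms lie in given
geometric intervals. -/
theorem measure_cell_le (hX : IsRewardProcess P ℱ X μ C)
    (hA : ∀ t B, MeasurableSet[ℱ t] {ω | A (t + 1) ω = B}) (hCΓ : LePos C Γ)
    {lam : ℝ} (hlam : 0 < lam) {B : Finset (Fin d)} (hB : B.Nonempty) {f : ℝ} (hf : 0 ≤ f)
    {r : ℝ} (hr : 0 < r) {δ : ℝ} (hδ : 0 < δ) (k : Fin d → ℕ) (n : ℕ) :
    P {ω | (∀ i, pulls (fun s => A s ω) (n + 1) i ≠ 0) ∧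
      (∀ i ∈ B, r ^ k i ≤ pulls (fun s => A s ω) (n + 1) i ∧
        (pulls (fun s => A s ω) (n + 1) i : ℝ) ≤ r ^ (k i + 1)) ∧
      2 * f * (widthSq Γ lam (fun s => A s ω) (n + 1) B + lam * δ * B.card) <
        (∑ i ∈ B, muHat (fun s => A s ω) (fun s => X s ω) (n + 1) i - meanReward μ B) ^ 2} ≤
    ENNReal.ofReal (Real.exp (-f) * Real.sqrt (1 + r / lam) ^ B.card) := by
  have hC0 : ∀ i, 0 ≤ C i i := fun i => hX.posSemidef.diag_nonneg
  have hΓ0 : ∀ i, 0 ≤ Γ i i := fun i => (hC0 i).trans (hCΓ.diag_le i)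
  -- In the cell, `p i` is a deterministic stand-in for `lam * Γ i i * N i`, correct up to a factor
  -- `r`: as `r ^ k i ≤ N i`, the prior term in direction `1 / N` stays below the regularization of
  -- the width, and `N i ≤ r ^ (k i + 1)` allows `κ = r / lam`. The slack `δ` keeps `p` positive
  -- when `Γ i i = 0`; off `B` the value `1` is arbitrary.
  set p : Fin d → ℝ := fun i => if i ∈ B then lam * (Γ i i + δ) * r ^ k i else 1 with hp
  set κ : Fin d → ℝ := fun i => if i ∈ B then r / lam else 0 with hκ
  have hp0 : ∀ i, 0 < p i := by
    intro i
    simp only [hp]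
    split_ifs
    · have := hΓ0 i
      positivity
    · exact one_pos
  have hκ0 : ∀ i, 0 ≤ κ i := by
    intro i
    simp only [hκ]
    split_ifs
    · positivity
    · exact le_rfl
  have hprod : ∏ i, Real.sqrt (1 + κ i) = Real.sqrt (1 + r / lam) ^ B.card := by
    rw [← Finset.prod_const, ← Finset.prod_subset (Finset.subset_univ B)]
    · exact Finset.prod_congr rfl fun i hi => by simp [hκ, hi]
    · intro i _ hi
      simp [hκ, hi]
  rw [← hprod]
  refine (measure_mono ?_).trans (measure_self_normalized_le hX hA B hp0 hκ0 n f)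
  rintro ω ⟨hN, hcell, hdev⟩
  set a : ℕ → Finset (Fin d) := fun s => A s ω with ha
  set v : Fin d → ℝ := fun i => (pulls a (n + 1) i : ℝ)⁻¹ with hv
  have hNpos : ∀ i, 0 < (pulls a (n + 1) i : ℝ) := fun i => by
    exact_mod_cast Nat.pos_of_ne_zero (hN i)
  have hN1 : ∀ i, 1 ≤ (pulls a (n + 1) i : ℝ) := fun i => by
    exact_mod_cast Nat.pos_of_ne_zero (hN i)
  have hv0 : ∀ i, 0 ≤ v i := fun i => (inv_pos.2 (hNpos i)).le
  have hpv : ∑ i, p i * restr B v i ^ 2 = ∑ i ∈ B, lam * (Γ i i + δ) * r ^ k i * v i ^ 2 := by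
    rw [← Finset.sum_subset (Finset.subset_univ B)]
    · exact Finset.sum_congr rfl fun i hi => by simp [hp, restr, hi]
    · intro i _ hi
      simp [restr, hi]
  refine ⟨fun i => ?_, restr B v, ?_, ?_⟩
  · rw [covSum_self]
    by_cases hi : i ∈ B
    · simp only [hp, hκ, hi, if_true]
      have h1 := (hcell i hi).2
      have h2 := hCΓ.diag_le i
      calc (pulls a (n + 1) i : ℝ) * C i i ≤ r ^ (k i + 1) * (Γ i i + δ) := by
            refine mul_le_mul h1 (by linarith) (hC0 i) (by positivity)
        _ = r / lam * (lam * (Γ i i + δ) * r ^ k i) := by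
            field_simp
            ring
    · simp [hκ, hi]
  · have h1 : 0 < ∑ i, p i * restr B v i ^ 2 := by
      rw [hpv]
      refine Finset.sum_pos (fun i _ => ?_) hB
      have h2 := hΓ0 i
      have h3 : 0 < v i := inv_pos.2 (hNpos i)
      positivity
    have h2 := sum_covSum_nonneg hX.posSemidef B a (n + 1) (restr B v)
    linarith
  · rw [← sum_muHat_sub B μ (fun s => X s ω) hN]
    refine lt_of_le_of_lt ?_ hdev
    refine mul_le_mul_of_nonneg_left ?_ (by positivity)
    have h1 := sum_covSum_restr_le hCΓ B a (n + 1) hv0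
    have h2 : ∑ i, p i * restr B v i ^ 2 ≤
        lam * ∑ i ∈ B, Γ i i / (pulls a (n + 1) i : ℝ) + lam * δ * B.card := by
      rw [hpv, Finset.mul_sum, ← nsmul_eq_mul', ← Finset.sum_const, ← Finset.sum_add_distrib]
      refine Finset.sum_le_sum fun i hi => ?_
      have h3 := (hcell i hi).1
      have h4 := hΓ0 i
      have h5 := hNpos i
      have h6 : r ^ k i * v i ^ 2 ≤ v i := by
        calc r ^ k i * v i ^ 2 ≤ pulls a (n + 1) i * v i ^ 2 := by gcongr
          _ = v i := by simp only [hv]; field_simp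
      have h7 : v i ≤ 1 := inv_le_one_of_one_le₀ (hN1 i)
      calc lam * (Γ i i + δ) * r ^ k i * v i ^ 2 = lam * (Γ i i + δ) * (r ^ k i * v i ^ 2) := by
            ring
        _ ≤ lam * (Γ i i + δ) * v i := by gcongr
        _ = lam * (Γ i i * v i) + lam * δ * v i := by ring
        _ ≤ lam * (Γ i i / pulls a (n + 1) i) + lam * δ * 1 := by
            gcongr
            exact le_of_eq (div_eq_mul_inv _ _).symm
        _ = _ := by ring
    unfold widthSq
    linarith

/-- The index of an action is an upper confidence bound of its mean, with high probability. -/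
theorem measure_index_lt_meanReward_le (hX : IsRewardProcess P ℱ X μ C)
    (hA : ∀ t B, MeasurableSet[ℱ t] {ω | A (t + 1) ω = B}) (hCΓ : LePos C Γ)
    {lam : ℝ} (hlam : 0 < lam) {B : Finset (Fin d)} (hB : B.Nonempty) (hm : B.card = m)
    {t : ℕ} (ht : 3 ≤ t) :
    P {ω | (∀ i, pulls (fun s => A s ω) t i ≠ 0) ∧
      index m Γ lam (fun s => A s ω) (fun s => X s ω) t B < meanReward μ B} ≤
    ENNReal.ofReal (1 / (t * Real.log t ^ 2)) := by
  obtain ⟨n, rfl⟩ : ∃ n, t = n + 1 := ⟨t - 1, by omega⟩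
  set L := Real.log ((n + 1 : ℕ) : ℝ) with hL
  have hn3 : (3 : ℝ) ≤ ((n + 1 : ℕ) : ℝ) := by exact_mod_cast ht
  have hL1 : 1 ≤ L := by
    rw [hL, Real.le_log_iff_exp_le (by linarith)]
    linarith [Real.exp_one_lt_d9]
  set f := explore m lam (n + 1) with hf
  have hf0 : 0 ≤ f := explore_nonneg hlam ht
  have hK1 : 1 ≤ ⌊L⌋₊ := Nat.le_floor (by simpa using hL1)
  set K := ⌊L⌋₊ with hK
  -- The ratio is chosen so that `r ^ K` is exactly the stage, hence the exponents `0, …, K - 1`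
  -- cover all possible counts.
  set r := Real.exp (L / K) with hr
  have hr0 : 0 < r := Real.exp_pos _
  have hr1 : 1 < r := Real.one_lt_exp_iff.2 (by positivity)
  have hrK : r ^ K = ((n + 1 : ℕ) : ℝ) := by
    rw [hr, ← Real.exp_nat_mul, mul_div_cancel₀ _ (by positivity), hL,
      Real.exp_log (by linarith)]
  -- The width is enlarged by a slack `δ`. The bound below does not depend on `δ`, and the strict
  -- deviation event is an increasing union of these events as `δ → 0`.
  let E : ℝ → Set Ω := fun δ => {ω | (∀ i, pulls (fun s => A s ω) (n + 1) i ≠ 0) ∧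
      2 * f * (widthSq Γ lam (fun s => A s ω) (n + 1) B + lam * δ * B.card) <
        (∑ i ∈ B, muHat (fun s => A s ω) (fun s => X s ω) (n + 1) i - meanReward μ B) ^ 2}
  have hE : ∀ δ, 0 < δ → P (E δ) ≤ ENNReal.ofReal (1 / ((n + 1 : ℕ) * L ^ 2)) := by
    intro δ hδ
    -- Exponents off `B` are frozen at `0`, so that there are `K ^ m` cells and not `K ^ d`.
    let F : Finset (Fin d → ℕ) :=
      Fintype.piFinset fun i => if i ∈ B then Finset.range K else {0}
    have hcard : F.card = K ^ m := by
      rw [Fintype.card_piFinset, ← hm, ← Finset.prod_const,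
        ← Finset.prod_subset (Finset.subset_univ B)]
      · exact Finset.prod_congr rfl fun i hi => by simp [hi]
      · intro i _ hi
        simp [hi]
    have hsub : E δ ⊆ ⋃ k ∈ F, {ω | (∀ i, pulls (fun s => A s ω) (n + 1) i ≠ 0) ∧
      (∀ i ∈ B, r ^ k i ≤ pulls (fun s => A s ω) (n + 1) i ∧
        (pulls (fun s => A s ω) (n + 1) i : ℝ) ≤ r ^ (k i + 1)) ∧
      2 * f * (widthSq Γ lam (fun s => A s ω) (n + 1) B + lam * δ * B.card) <
        (∑ i ∈ B, muHat (fun s => A s ω) (fun s => X s ω) (n + 1) i - meanReward μ B) ^ 2} := by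
      rintro ω ⟨hN, hdev⟩
      have hex : ∀ i, ∃ k : ℕ, r ^ k ≤ pulls (fun s => A s ω) (n + 1) i ∧
          (pulls (fun s => A s ω) (n + 1) i : ℝ) < r ^ (k + 1) := fun i =>
        exists_nat_pow_near (by exact_mod_cast Nat.pos_of_ne_zero (hN i)) hr1
      choose k hk1 hk2 using hex
      have hkK : ∀ i, k i < K := by
        intro i
        rw [← pow_lt_pow_iff_right₀ hr1, hrK]
        refine (hk1 i).trans_lt ?_
        exact_mod_cast pulls_lt (fun s => A s ω) (by omega) i
      refine Set.mem_biUnion (x := fun i => if i ∈ B then k i else 0) ?_ ⟨hN, ?_, hdev⟩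
      · simp only [F, Finset.mem_coe, Fintype.mem_piFinset]
        intro i
        by_cases hi : i ∈ B
        · simpa [hi] using hkK i
        · simp [hi]
      · intro i hi
        simp only [hi, if_true]
        exact ⟨hk1 i, (hk2 i).le⟩
    calc P (E δ) ≤ ∑ k ∈ F, ENNReal.ofReal (Real.exp (-f) * Real.sqrt (1 + r / lam) ^ B.card) :=
          (measure_mono hsub).trans ((measure_biUnion_finset_le _ _).trans
            (Finset.sum_le_sum fun k _ => measure_cell_le hX hA hCΓ hlam hB hf0 hr0 hδ k n))
      _ = ENNReal.ofReal (K ^ m * (Real.exp (-f) * Real.sqrt (1 + r / lam) ^ m)) := by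
          rw [Finset.sum_const, hcard, hm, nsmul_eq_mul, ← Nat.cast_pow,
            ENNReal.ofReal_mul (Nat.cast_nonneg _), ENNReal.ofReal_natCast]
      _ ≤ _ := by
          refine ENNReal.ofReal_le_ofReal ?_
          have h1 := floor_log_mul_sqrt_le hlam hL1
          have hs : 0 < Real.sqrt (1 + Real.exp 1 / lam) := by positivity
          calc K ^ m * (Real.exp (-f) * Real.sqrt (1 + r / lam) ^ m)
              = (K * Real.sqrt (1 + r / lam)) ^ m * Real.exp (-f) := by
                rw [mul_pow]; ring
            _ ≤ (L * Real.sqrt (1 + Real.exp 1 / lam)) ^ m * Real.exp (-f) := by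
                gcongr
            _ = _ := by
                rw [hf, exp_neg_explore hlam (by omega), ← hL]
                have : 0 < L := by linarith
                field_simp
                ring
  have hsub : {ω | (∀ i, pulls (fun s => A s ω) (n + 1) i ≠ 0) ∧
      index m Γ lam (fun s => A s ω) (fun s => X s ω) (n + 1) B < meanReward μ B} ⊆
      ⋃ k : ℕ, E (1 / ((k : ℝ) + 1)) := by
    rintro ω ⟨hN, hlt⟩
    set a : ℕ → Finset (Fin d) := fun s => A s ω with ha
    rw [index, bonus_eq Γ lam hN, ← Real.sqrt_mul (by positivity), ← hf] at hlt
    set y := ∑ i ∈ B, muHat a (fun s => X s ω) (n + 1) i - meanReward μ B with hy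
    set W := widthSq Γ lam a (n + 1) B with hW
    have hs : Real.sqrt (2 * f * W) < -y := by linarith
    have hlt' : 2 * f * W < y ^ 2 := by
      have := (Real.sqrt_lt' (lt_of_le_of_lt (Real.sqrt_nonneg _) hs)).1 hs
      simpa using this
    have hlim : Filter.Tendsto (fun k : ℕ => 2 * f * (W + lam * (1 / ((k : ℝ) + 1)) * B.card))
        Filter.atTop (nhds (2 * f * (W + lam * 0 * B.card))) := by
      have := tendsto_one_div_add_atTop_nhds_zero_nat (𝕜 := ℝ)
      exact ((((this.const_mul lam).mul_const _).const_add W).const_mul _)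
    rw [mul_zero, zero_mul, add_zero] at hlim
    obtain ⟨k, hk⟩ := (hlim.eventually (gt_mem_nhds hlt')).exists
    exact Set.mem_iUnion.2 ⟨k, hN, hk⟩
  have hmono : Monotone (fun k : ℕ => E (1 / ((k : ℝ) + 1))) := by
    intro k l hkl ω hω
    refine ⟨hω.1, lt_of_le_of_lt ?_ hω.2⟩
    have : 1 / ((l : ℝ) + 1) ≤ 1 / ((k : ℝ) + 1) := by gcongr
    gcongr
  refine (measure_mono hsub).trans ?_
  rw [hmono.measure_iUnion]
  exact iSup_le fun k => hE _ (by positivity)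

end Probability

/-! ### Numbers of pulls and deviations of a single arm. -/

theorem pulls_succ (a : ℕ → Finset (Fin d)) {t : ℕ} (ht : 1 ≤ t) (i : Fin d) :
    pulls a (t + 1) i = pulls a t i + if i ∈ a t then 1 else 0 := by
  unfold pulls
  rw [Finset.card_filter, Finset.card_filter, Finset.sum_Ico_succ_top ht]

theorem pulls_mono (a : ℕ → Finset (Fin d)) (i : Fin d) : Monotone fun t => pulls a t i :=
  fun _ _ h => Finset.card_le_card
    (Finset.filter_subset_filter _ (Finset.Ico_subset_Ico_right h))

theorem pulls_lt_pulls (a : ℕ → Finset (Fin d)) {i : Fin d} {s t : ℕ} (hs : 1 ≤ s) (hst : s < t)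
    (hi : i ∈ a s) : pulls a s i < pulls a t i := by
  have h1 := pulls_succ a hs i
  have h2 : pulls a (s + 1) i ≤ pulls a t i := pulls_mono a i hst
  simp only [hi, if_true] at h1
  omega

/-- Sums over the stages that precede the `n`-th pull of arm `i`. -/
theorem sum_before_pull (a : ℕ → Finset (Fin d)) {i : Fin d} {n t T : ℕ}
    (htT : t ≤ T) (hn : pulls a t i = n) (g : ℕ → ℝ) :
    ∑ s ∈ Finset.Ico 1 (T + 1), (if i ∈ a s ∧ pulls a s i < n then g s else 0) =
      ∑ s ∈ Finset.Ico 1 t, if i ∈ a s then g s else 0 := by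
  symm
  refine Finset.sum_subset_zero_on_sdiff (Finset.Ico_subset_Ico_right (by omega)) ?_ ?_
  · intro s hs
    simp only [Finset.mem_sdiff, Finset.mem_Ico, not_and, not_lt] at hs
    have h1 : pulls a t i ≤ pulls a s i := pulls_mono a i (hs.2 hs.1.1)
    rw [if_neg]
    omega
  · intro s hs
    obtain ⟨h1, h2⟩ := Finset.mem_Ico.1 hs
    by_cases hi : i ∈ a s
    · have := pulls_lt_pulls a h1 h2 hi
      rw [if_pos hi, if_pos ⟨hi, by omega⟩]
    · rw [if_neg hi, if_neg (fun h => hi h.1)]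

/-- Telescoping: `x ≤ exp x - 1` gives `x * exp (-n x) ≤ exp (-(n - 1) x) - exp (-n x)`. -/
theorem sum_exp_neg_mul_le {x : ℝ} (hx : 0 < x) (T : ℕ) :
    ∑ n ∈ Finset.Icc 1 T, Real.exp (-(n * x)) ≤ 1 / x := by
  rw [le_div_iff₀ hx]
  have key : ∀ T : ℕ, (∑ n ∈ Finset.Icc 1 T, Real.exp (-(n * x))) * x ≤
      1 - Real.exp (-(T * x)) := by
    intro T
    induction T with
    | zero => simp
    | succ T ih =>
      rw [Finset.sum_Icc_succ_top (by omega), add_mul]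
      have e : Real.exp (-(T * x)) = Real.exp (-((T + 1 : ℕ) * x)) * Real.exp x := by
        rw [← Real.exp_add]
        congr 1
        push_cast
        ring
      rw [e] at ih
      have h1 := Real.add_one_le_exp x
      have h2 := Real.exp_pos (-((T + 1 : ℕ) * x))
      nlinarith
  linarith [key T, Real.exp_pos (-(T * x))]

section Probability

variable [mΩ : MeasurableSpace Ω] {P : Measure Ω} [IsProbabilityMeasure P] {ℱ : Filtration ℕ mΩ}
  {X : ℕ → Ω → Fin d → ℝ} {μ : Fin d → ℝ} {C : Matrix (Fin d) (Fin d) ℝ}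
  {A : ℕ → Ω → Finset (Fin d)}

/-- The event that the average of the first `n` rewards of arm `i`, obtained before stage `T`,
exceeds its mean by at least `ε`. -/
def deviationEvent (X : ℕ → Ω → Fin d → ℝ) (μ : Fin d → ℝ) (A : ℕ → Ω → Finset (Fin d))
    (T : ℕ) (ε : ℝ) (i : Fin d) (n : ℕ) : Set Ω :=
  {ω | ∃ t, t ≤ T ∧ pulls (fun s => A s ω) t i = n ∧
    n * ε ≤ ∑ s ∈ Finset.Ico 1 t, if i ∈ A s ω then X s ω i - μ i else 0}

/-- A predictable direction equal to `u` on arm `i` during its first `n` pulls and `0` otherwise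
freezes the exponential after the `n`-th pull. Its value at the fixed horizon `T` then covers every
`t` in the event without a union bound; `u = ε / c` optimizes the Chernoff exponent. -/
theorem measure_deviationEvent_le (hX : IsRewardProcess P ℱ X μ C)
    (hA : ∀ t B, MeasurableSet[ℱ t] {ω | A (t + 1) ω = B}) {ε c : ℝ} (hε : 0 ≤ ε) (hc : 0 < c)
    {i : Fin d} (hCc : C i i ≤ c) (T n : ℕ) :
    P.real (deviationEvent X μ A T ε i n) ≤ Real.exp (-(n * (ε ^ 2 / (2 * c)))) := by
  set u := ε / c with hu
  have hu0 : 0 ≤ u := by positivity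
  have hU := fun t => measurable_of_actions (β := Fin d → ℝ) hA (n := t)
    (H := fun a => Pi.single i (if i ∈ a (t + 1) ∧ pulls a (t + 1) i < n then u else 0))
    (fun a b h => by
      have : pulls a (t + 1) i = pulls b (t + 1) i := by
        unfold pulls
        congr 1
        refine Finset.filter_congr fun s hs => ?_
        rw [h s (by simp only [Finset.mem_Ico, Finset.mem_Icc] at *; omega)]
      simp only [h (t + 1) (by simp), this])
  have key := lintegral_exp_compensated_le_one hX
    (U := fun s ω => Pi.single i (if i ∈ A s ω ∧ pulls (fun s => A s ω) s i < n then u else 0))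
    (fun t => (hU t).1) (fun t => (hU t).2) T
  set Z : Ω → ENNReal := fun ω => ENNReal.ofReal (Real.exp (∑ s ∈ Finset.Ico 1 (T + 1),
    (Pi.single i (if i ∈ A s ω ∧ pulls (fun s => A s ω) s i < n then u else 0) ⬝ᵥ (X s ω - μ) -
      1 / 2 * (Pi.single i (if i ∈ A s ω ∧ pulls (fun s => A s ω) s i < n then u else 0) ⬝ᵥ
        (C *ᵥ Pi.single i
          (if i ∈ A s ω ∧ pulls (fun s => A s ω) s i < n then u else 0)))))) with hZ
  have hZm : Measurable Z := by
    refine ENNReal.measurable_ofReal.comp (Real.measurable_exp.comp ?_)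
    refine Finset.measurable_sum _ fun s hs => ?_
    obtain ⟨k, rfl⟩ : ∃ k, s = k + 1 := ⟨s - 1, by have := (Finset.mem_Ico.1 hs).1; omega⟩
    have hUk := ((hU k).1).mono (ℱ.le _) le_rfl
    have hXk : Measurable (X (k + 1)) := (hX.adapted k).mono (ℱ.le _) le_rfl
    unfold Matrix.mulVec dotProduct
    fun_prop
  set b := Real.exp (n * (ε ^ 2 / (2 * c))) with hb
  have hb0 : 0 < b := Real.exp_pos _
  have hsub : deviationEvent X μ A T ε i n ⊆ {ω | ENNReal.ofReal b ≤ Z ω} := by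
    rintro ω ⟨t, htT, hn, hdev⟩
    refine ENNReal.ofReal_le_ofReal (Real.exp_le_exp.2 ?_)
    have e : ∀ s, Pi.single i (if i ∈ A s ω ∧ pulls (fun s => A s ω) s i < n then u else 0) ⬝ᵥ
        (X s ω - μ) - 1 / 2 * (Pi.single i
          (if i ∈ A s ω ∧ pulls (fun s => A s ω) s i < n then u else 0) ⬝ᵥ (C *ᵥ Pi.single i
          (if i ∈ A s ω ∧ pulls (fun s => A s ω) s i < n then u else 0))) =
        if i ∈ A s ω ∧ pulls (fun s => A s ω) s i < n then
          u * (X s ω i - μ i) - 1 / 2 * (u ^ 2 * C i i) else 0 := by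
      intro s
      split_ifs
      · simp
        ring
      · simp
    rw [Finset.sum_congr rfl fun s _ => e s, sum_before_pull (fun s => A s ω) htT hn]
    have e2 : ∑ s ∈ Finset.Ico 1 t, (if i ∈ A s ω then
        u * (X s ω i - μ i) - 1 / 2 * (u ^ 2 * C i i) else 0) =
        u * (∑ s ∈ Finset.Ico 1 t, if i ∈ A s ω then X s ω i - μ i else 0) -
          n * (1 / 2 * (u ^ 2 * C i i)) := by
      rw [← hn, pulls, Finset.mul_sum, Finset.card_filter]
      push_cast
      rw [Finset.sum_mul, ← Finset.sum_sub_distrib]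
      refine Finset.sum_congr rfl fun s _ => ?_
      split_ifs <;> ring
    rw [e2]
    have h1 := mul_le_mul_of_nonneg_left hdev hu0
    have h2 : n * (1 / 2 * (u ^ 2 * C i i)) ≤ n * (1 / 2 * (u ^ 2 * c)) := by gcongr
    have h3 : u * (n * ε) - n * (1 / 2 * (u ^ 2 * c)) = n * (ε ^ 2 / (2 * c)) := by
      rw [hu]
      field_simp
      ring
    linarith
  have hm := (mul_meas_ge_le_lintegral₀ (μ := P) hZm.aemeasurable (ENNReal.ofReal b)).trans key
  have h2 : ENNReal.ofReal b * P (deviationEvent X μ A T ε i n) ≤ 1 :=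
    (by gcongr : _ ≤ ENNReal.ofReal b * P {ω | ENNReal.ofReal b ≤ Z ω}).trans hm
  have h3 := ENNReal.toReal_mono ENNReal.one_ne_top h2
  rw [ENNReal.toReal_mul, ENNReal.toReal_ofReal hb0.le, ENNReal.toReal_one] at h3
  rw [Real.exp_neg, ← hb, measureReal_def, inv_eq_one_div, le_div_iff₀ hb0, mul_comm]
  exact h3

theorem sum_measure_deviationEvent_le (hX : IsRewardProcess P ℱ X μ C)
    (hA : ∀ t B, MeasurableSet[ℱ t] {ω | A (t + 1) ω = B}) {ε : ℝ} (hε : 0 < ε)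
    (i : Fin d) (T : ℕ) :
    ∑ n ∈ Finset.Icc 1 T, P.real (deviationEvent X μ A T ε i n) ≤ 2 * C i i / ε ^ 2 := by
  have hC0 : 0 ≤ C i i := hX.posSemidef.diag_nonneg
  have h1 : (∑ n ∈ Finset.Icc 1 T, P.real (deviationEvent X μ A T ε i n)) * ε ^ 2 / 2 ≤ C i i := by
    -- `C i i` may vanish, so the exponential bound is applied with variance `C i i + η`.
    refine le_of_forall_pos_le_add fun η hη => ?_
    have h2 : ∑ n ∈ Finset.Icc 1 T, P.real (deviationEvent X μ A T ε i n) ≤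
        1 / (ε ^ 2 / (2 * (C i i + η))) :=
      (Finset.sum_le_sum fun n _ => measure_deviationEvent_le hX hA hε.le
        (by linarith) (by linarith) T n).trans (sum_exp_neg_mul_le (by positivity) T)
    calc _ ≤ (1 / (ε ^ 2 / (2 * (C i i + η)))) * ε ^ 2 / 2 := by gcongr
      _ = C i i + η := by field_simp
  rw [le_div_iff₀ (by positivity)]
  linarith

end Probability

/-! ### Elementary sums. -/

/-- Comparison with the telescoping sum of `1 / log (t - 1) - 1 / log t`, bounded by `1 / log 2 ≤
2`. -/
theorem sum_inv_mul_log_sq_le (T : ℕ) :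
    ∑ t ∈ Finset.Icc 3 T, 1 / (t * Real.log t ^ 2) ≤ 2 := by
  have hl2 : 1 / Real.log 2 ≤ 2 := by
    rw [div_le_iff₀ (by positivity)]
    linarith [Real.log_two_gt_d9]
  have key : ∀ n : ℕ, ∑ t ∈ Finset.Icc 3 (n + 2), 1 / (t * Real.log t ^ 2) ≤
      1 / Real.log 2 - 1 / Real.log (n + 2 : ℕ) := by
    intro n
    induction n with
    | zero => simp
    | succ n ih =>
      rw [show n + 1 + 2 = (n + 2) + 1 by ring, Finset.sum_Icc_succ_top (by omega)]
      set L := Real.log ((n + 2 : ℕ) : ℝ) with hL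
      set L' := Real.log ((n + 2 + 1 : ℕ) : ℝ) with hL'
      have hp : (2 : ℝ) ≤ ((n + 2 : ℕ) : ℝ) := by push_cast; linarith [n.cast_nonneg (α := ℝ)]
      have hp' : ((n + 2 + 1 : ℕ) : ℝ) = ((n + 2 : ℕ) : ℝ) + 1 := by push_cast; ring
      have hL0 : 0 < L := Real.log_pos (by linarith)
      have hLL : L ≤ L' := Real.log_le_log (by linarith) (by linarith)
      have hdiff : 1 / ((n + 2 + 1 : ℕ) : ℝ) ≤ L' - L := by
        rw [hL, hL', ← Real.log_div (by linarith) (by linarith)]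
        have := Real.one_sub_inv_le_log_of_pos
          (x := ((n + 2 + 1 : ℕ) : ℝ) / ((n + 2 : ℕ) : ℝ)) (div_pos (by linarith) (by linarith))
        refine le_trans (le_of_eq ?_) this
        rw [inv_div, hp']
        have : ((n + 2 : ℕ) : ℝ) + 1 ≠ 0 := by linarith
        field_simp
        ring
      have h1 : 1 / (((n + 2 + 1 : ℕ) : ℝ) * L' ^ 2) ≤ 1 / L - 1 / L' := by
        calc 1 / (((n + 2 + 1 : ℕ) : ℝ) * L' ^ 2) = 1 / ((n + 2 + 1 : ℕ) : ℝ) / L' ^ 2 := by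
              rw [div_div]
          _ ≤ (L' - L) / L' ^ 2 := by gcongr
          _ ≤ (L' - L) / (L * L') := by
              refine div_le_div_of_nonneg_left (by linarith) (by nlinarith) (by nlinarith)
          _ = 1 / L - 1 / L' := by
              have : L' ≠ 0 := by linarith
              field_simp
      linarith
  rcases Nat.lt_or_ge T 3 with hT | hT
  · rw [Finset.Icc_eq_empty (by omega)]
    simp
  · obtain ⟨n, rfl⟩ : ∃ n, T = n + 2 := ⟨T - 2, by omega⟩
    have := key n
    have h2 : 0 ≤ 1 / Real.log ((n + 2 : ℕ) : ℝ) :=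
      div_nonneg zero_le_one (Real.log_nonneg (by push_cast; linarith [n.cast_nonneg (α := ℝ)]))
    linarith

theorem sum_inv_sqrt_le (n : ℕ) : ∑ N ∈ Finset.Icc 1 n, 1 / Real.sqrt N ≤ 2 * Real.sqrt n := by
  induction n with
  | zero => simp
  | succ n ih =>
    rw [Finset.sum_Icc_succ_top (by omega)]
    have h0 : 0 < Real.sqrt ((n + 1 : ℕ) : ℝ) := Real.sqrt_pos.2 (by positivity)
    have h1 : Real.sqrt (n : ℝ) ^ 2 = n := Real.sq_sqrt (by positivity)
    have h2 : Real.sqrt ((n + 1 : ℕ) : ℝ) ^ 2 = n + 1 := by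
      rw [Real.sq_sqrt (by positivity)]; push_cast; rfl
    have h3 : 1 / Real.sqrt ((n + 1 : ℕ) : ℝ) ≤
        2 * Real.sqrt ((n + 1 : ℕ) : ℝ) - 2 * Real.sqrt n := by
      rw [div_le_iff₀ h0]
      nlinarith [sq_nonneg (Real.sqrt ((n + 1 : ℕ) : ℝ) - Real.sqrt n)]
    linarith

theorem sum_two_mul_sqrt_div_le {b M : ℝ} (hb : 0 ≤ b) (hM : 0 ≤ M) (T : ℕ) :
    ∑ N ∈ Finset.Icc 1 T, (if (N : ℝ) ≤ M then 2 * Real.sqrt (b / N) else 0) ≤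
      4 * Real.sqrt (b * M) := by
  rw [← Finset.sum_filter]
  have hsub : (Finset.Icc 1 T).filter (fun N : ℕ => (N : ℝ) ≤ M) ⊆ Finset.Icc 1 ⌊M⌋₊ := by
    intro N hN
    simp only [Finset.mem_filter, Finset.mem_Icc] at hN ⊢
    exact ⟨hN.1.1, Nat.le_floor hN.2⟩
  calc _ ≤ ∑ N ∈ Finset.Icc 1 ⌊M⌋₊, 2 * Real.sqrt (b / N) :=
        Finset.sum_le_sum_of_subset_of_nonneg hsub fun _ _ _ => by positivity
    _ = 2 * Real.sqrt b * ∑ N ∈ Finset.Icc 1 ⌊M⌋₊, 1 / Real.sqrt N := by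
        rw [Finset.mul_sum]
        refine Finset.sum_congr rfl fun N _ => ?_
        rw [Real.sqrt_div hb]
        ring
    _ ≤ 2 * Real.sqrt b * (2 * Real.sqrt ⌊M⌋₊) := by
        gcongr
        exact sum_inv_sqrt_le _
    _ ≤ 2 * Real.sqrt b * (2 * Real.sqrt M) := by
        gcongr
        exact Nat.floor_le hM
    _ = _ := by rw [Real.sqrt_mul hb]; ring

/-- A concave majorant of the sums of `min (√(K / N)) (K / N)`. -/
theorem sum_min_sqrt_le {K : ℝ} (hK : 0 < K) (n : ℕ) :
    ∑ N ∈ Finset.Icc 1 n, 2 * min (Real.sqrt (K / N)) (K / N) ≤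
      if (n : ℝ) ≤ K then 4 * Real.sqrt (K * n) else 4 * K + 2 * K * Real.log (n / K) := by
  induction n with
  | zero => simp [hK.le]
  | succ n ih =>
    rw [Finset.sum_Icc_succ_top (by omega)]
    have hn0 : (0 : ℝ) ≤ n := n.cast_nonneg
    have hc : ((n + 1 : ℕ) : ℝ) = n + 1 := by push_cast; rfl
    rw [hc]
    set s := Real.sqrt K with hs
    have hs0 : 0 < s := Real.sqrt_pos.2 hK
    have hsq : s ^ 2 = K := Real.sq_sqrt hK.le
    have hsn : Real.sqrt n ^ 2 = n := Real.sq_sqrt hn0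
    have hsn1 : Real.sqrt (n + 1 : ℝ) ^ 2 = n + 1 := Real.sq_sqrt (by linarith)
    have hsn1p : 0 < Real.sqrt (n + 1 : ℝ) := Real.sqrt_pos.2 (by linarith)
    by_cases h1 : (n : ℝ) + 1 ≤ K
    · rw [if_pos (by linarith : (n : ℝ) ≤ K)] at ih
      rw [if_pos h1, Real.sqrt_mul hK.le]
      rw [Real.sqrt_mul hK.le] at ih
      have h2 : min (Real.sqrt (K / (n + 1))) (K / (n + 1)) ≤ s / Real.sqrt (n + 1) :=
        (min_le_left _ _).trans (le_of_eq (Real.sqrt_div hK.le _))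
      have h3 : s / Real.sqrt (n + 1 : ℝ) ≤ s * (2 * Real.sqrt (n + 1 : ℝ) - 2 * Real.sqrt n) := by
        rw [div_eq_mul_inv]
        refine mul_le_mul_of_nonneg_left ?_ hs0.le
        rw [inv_eq_one_div, div_le_iff₀ hsn1p]
        nlinarith [sq_nonneg (Real.sqrt (n + 1 : ℝ) - Real.sqrt n)]
      linarith
    · rw [if_neg h1]
      have h2 : min (Real.sqrt (K / (n + 1))) (K / (n + 1)) ≤ K / (n + 1) := min_le_right _ _
      push Not at h1
      -- If `n ≤ K < n + 1` the induction step crosses the breakpoint: `4 √(K n) ≤ 2 K + 2 n` bounds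
      -- the square-root branch by its tangent at `K`, and the logarithmic branch takes over.
      by_cases h3 : (n : ℝ) ≤ K
      · rw [if_pos h3, Real.sqrt_mul hK.le] at ih
        have h4 : Real.sqrt n ≤ s := Real.sqrt_le_sqrt h3
        have h5 : 4 * (s * Real.sqrt n) ≤ 4 * K - 2 * (K - n) := by
          nlinarith [sq_nonneg (s - Real.sqrt n)]
        have h6 := Real.one_sub_inv_le_log_of_pos (x := (n + 1) / K) (by positivity)
        rw [inv_div] at h6
        have h7 : K / (n + 1) ≤ 1 := by
          rw [div_le_one (by linarith)]; exact h1.le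
        have h8 : K * (1 - K / (n + 1)) ≤ K * Real.log ((n + 1) / K) :=
          mul_le_mul_of_nonneg_left h6 hK.le
        have h9 : K = K / (n + 1) * n + K / (n + 1) := by field_simp
        have h10 : 0 ≤ (1 - K / (n + 1)) * (K - n) :=
          mul_nonneg (by linarith) (by linarith)
        have h11 : K / (n + 1) * (n + 1) = K := by field_simp
        nlinarith
      · rw [if_neg h3] at ih
        push Not at h3
        have hnp : 0 < (n : ℝ) := hK.trans h3
        have h6 := Real.one_sub_inv_le_log_of_pos (x := ((n : ℝ) + 1) / n) (by positivity)
        have h7 : Real.log ((n + 1) / K) = Real.log (n / K) + Real.log ((n + 1) / n) := by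
          rw [← Real.log_mul (by positivity) (by positivity)]
          congr 1
          field_simp
        have h8 : K / (n + 1) = K * (1 - (((n : ℝ) + 1) / n)⁻¹) := by
          field_simp
          ring
        have h9 := mul_le_mul_of_nonneg_left h6 hK.le
        rw [h7]
        linarith

/-- Counts up to `K` contribute at most `4 K` through the square root; those from `K` to `2 m K` add
a harmonic sum, at most `2 K log (2 m)`. -/
theorem sum_truncated_min_le {K : ℝ} (hK : 0 ≤ K) (hm : 1 ≤ m) (T : ℕ) :
    ∑ N ∈ Finset.Icc 1 T,
      (if (N : ℝ) ≤ 2 * m * K then 2 * min (Real.sqrt (K / N)) (K / N) else 0) ≤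
      K * (4 + 2 * Real.log (2 * m)) := by
  have hm1 : (1 : ℝ) ≤ m := by exact_mod_cast hm
  have hlog : 0 ≤ Real.log (2 * m) := Real.log_nonneg (by linarith)
  rcases hK.eq_or_lt with rfl | hK
  · simp
  rw [← Finset.sum_filter]
  set M := 2 * m * K with hM
  have hM0 : 0 < M := by positivity
  have hsub : (Finset.Icc 1 T).filter (fun N : ℕ => (N : ℝ) ≤ M) ⊆ Finset.Icc 1 ⌊M⌋₊ := by
    intro N hN
    simp only [Finset.mem_filter, Finset.mem_Icc] at hN ⊢
    exact ⟨hN.1.1, Nat.le_floor hN.2⟩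
  refine (Finset.sum_le_sum_of_subset_of_nonneg hsub fun _ _ _ => by positivity).trans ?_
  refine (sum_min_sqrt_le hK ⌊M⌋₊).trans ?_
  have hfl := Nat.floor_le hM0.le
  split_ifs with h
  · have : Real.sqrt (K * ⌊M⌋₊) ≤ K := by
      rw [Real.sqrt_le_left hK.le]
      nlinarith
    nlinarith [mul_nonneg hK.le hlog]
  · push Not at h
    have : Real.log (⌊M⌋₊ / K) ≤ Real.log (2 * m) := by
      refine Real.log_le_log (div_pos (hK.trans h) hK) ?_
      rw [div_le_iff₀ hK]
      exact hfl
    nlinarith [mul_le_mul_of_nonneg_left this hK.le]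

/-! ### Charging gaps to arms. -/

/-- Charging a gap to the arms of the action, when the squared gap is at most a sum of
variances. -/
theorem gap_le_sum_charge_of_sum {ι : Type*} {D : Finset ι} (hD : D.card = m) (hm : 1 ≤ m)
    {δ G : ι → ℝ} {N : ι → ℕ} {Δ θ : ℝ} (hΔ : 0 < Δ) (hθ : 0 ≤ θ) (hG : ∀ i, 0 ≤ G i)
    (hδ : ∀ i ∈ D, 0 < δ i ∧ δ i ≤ Δ) (hN : ∀ i ∈ D, 1 ≤ N i)
    (h : Δ ^ 2 ≤ θ * ∑ i ∈ D, G i / N i) :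
    Δ ≤ ∑ i ∈ D, δ i * (if (N i : ℝ) ≤ 2 * m * (θ * G i / δ i ^ 2) then
      2 * min (Real.sqrt (θ * G i / δ i ^ 2 / N i)) (θ * G i / δ i ^ 2 / N i) else 0) := by
  have hm1 : (1 : ℝ) ≤ m := by exact_mod_cast hm
  have hnn : ∀ i ∈ D, 0 ≤ δ i * (if (N i : ℝ) ≤ 2 * m * (θ * G i / δ i ^ 2) then
      2 * min (Real.sqrt (θ * G i / δ i ^ 2 / N i)) (θ * G i / δ i ^ 2 / N i) else 0) := by
    intro i hi
    have h1 := (hδ i hi).1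
    have h2 := hG i
    split_ifs <;> positivity
  have hsqrt : ∀ i ∈ D, δ i * Real.sqrt (θ * G i / δ i ^ 2 / N i) = Real.sqrt (θ * G i / N i) := by
    intro i hi
    have h1 := (hδ i hi).1
    rw [← Real.sqrt_sq h1.le, ← Real.sqrt_mul (by positivity), Real.sqrt_sq h1.le]
    congr 1
    field_simp
  have hNp : ∀ i ∈ D, 0 < (N i : ℝ) := fun i hi => by exact_mod_cast hN i hi
  -- If one variance alone reaches `Δ²`, its arm pays for the whole gap. Otherwise every standard
  -- deviation is below `Δ`, which is what yields the square-root half of the minimum.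
  by_cases hex : ∃ i ∈ D, Δ ^ 2 ≤ θ * G i / N i
  · obtain ⟨i, hi, hle⟩ := hex
    have h1 := (hδ i hi).1
    have h2 := hNp i hi
    have h3 : 0 ≤ θ * G i := mul_nonneg hθ (hG i)
    have hK1 : 1 ≤ θ * G i / δ i ^ 2 / N i := by
      rw [div_right_comm, le_div_iff₀ (by positivity), one_mul]
      exact (pow_le_pow_left₀ h1.le (hδ i hi).2 2).trans hle
    refine le_trans ?_ (Finset.single_le_sum hnn hi)
    have hcond : (N i : ℝ) ≤ 2 * m * (θ * G i / δ i ^ 2) := by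
      rw [le_div_iff₀ h2, one_mul] at hK1
      nlinarith
    rw [if_pos hcond, min_eq_left]
    · calc Δ ≤ Real.sqrt (θ * G i / N i) := Real.le_sqrt_of_sq_le hle
        _ ≤ 2 * Real.sqrt (θ * G i / N i) := by linarith [Real.sqrt_nonneg (θ * G i / N i)]
        _ = _ := by rw [← hsqrt i hi]; ring
    · rw [Real.sqrt_le_left (by linarith)]
      nlinarith
  · push Not at hex
    -- Doubling the sum and subtracting `Δ / m` per arm loses nothing in total, but makes the term
    -- of every arm whose count is above the threshold nonpositive.
    have h1 : Δ ≤ ∑ i ∈ D, (2 * (θ * G i / N i) / Δ - Δ / m) := by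
      rw [Finset.sum_sub_distrib, Finset.sum_const, hD, nsmul_eq_mul,
        mul_div_cancel₀ _ (by positivity), ← Finset.sum_div, ← Finset.mul_sum]
      have e : ∑ i ∈ D, θ * G i / N i = θ * ∑ i ∈ D, G i / N i := by
        rw [Finset.mul_sum]
        exact Finset.sum_congr rfl fun i _ => by ring
      rw [e, le_sub_iff_add_le, le_div_iff₀ hΔ]
      nlinarith
    refine h1.trans (Finset.sum_le_sum fun i hi => ?_)
    have h2 := hNp i hi
    obtain ⟨h3, h4⟩ := hδ i hi
    have h5 : 0 ≤ θ * G i := mul_nonneg hθ (hG i)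
    by_cases hcond : (N i : ℝ) ≤ 2 * m * (θ * G i / δ i ^ 2)
    · rw [if_pos hcond]
      have hb : 2 * (θ * G i / N i) / Δ - Δ / m ≤ 2 * (θ * G i / N i) / Δ := by
        have : 0 ≤ Δ / m := by positivity
        linarith
      refine hb.trans ?_
      rw [mul_left_comm, mul_min_of_nonneg _ _ h3.le, hsqrt i hi, mul_div_assoc]
      refine mul_le_mul_of_nonneg_left (le_min ?_ ?_) (by norm_num)
      · rw [div_le_iff₀ hΔ]
        have h6 : Real.sqrt (θ * G i / N i) ≤ Δ := by
          rw [Real.sqrt_le_left hΔ.le]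
          exact (hex i hi).le
        have h7 := Real.sq_sqrt (by positivity : 0 ≤ θ * G i / N i)
        nlinarith [Real.sqrt_nonneg (θ * G i / N i)]
      · calc θ * G i / N i / Δ ≤ θ * G i / N i / δ i := by gcongr
          _ = _ := by field_simp
    · rw [if_neg hcond, mul_zero, sub_nonpos]
      push Not at hcond
      rw [div_le_div_iff₀ hΔ (by positivity)]
      have h6 : 2 * m * (θ * G i / δ i ^ 2) * δ i ^ 2 < N i * δ i ^ 2 := by gcongr
      have h7 : 2 * m * (θ * G i / δ i ^ 2) * δ i ^ 2 = 2 * m * (θ * G i) := by field_simp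
      have h8 : δ i ^ 2 ≤ Δ ^ 2 := by gcongr
      have h9 : 2 * m * (θ * G i) ≤ N i * Δ ^ 2 := by nlinarith
      calc 2 * (θ * G i / N i) * m = 2 * m * (θ * G i) / N i := by ring
        _ ≤ N i * Δ ^ 2 / N i := by gcongr
        _ = Δ * Δ := by field_simp

/-- Charging a gap to the arms of the action, when the gap is at most a sum of standard
deviations. -/
theorem gap_le_sum_charge_of_sq_sum {ι : Type*} {D : Finset ι} (hD : D.card = m) (hm : 1 ≤ m)
    {δ G : ι → ℝ} {N : ι → ℕ} {Δ θ : ℝ} (hΔ : 0 < Δ) (hθ : 0 ≤ θ) (hG : ∀ i, 0 ≤ G i)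
    (hδ : ∀ i ∈ D, 0 < δ i ∧ δ i ≤ Δ) (hN : ∀ i ∈ D, 1 ≤ N i)
    (h : Δ ^ 2 ≤ θ * (∑ i ∈ D, Real.sqrt (G i / N i)) ^ 2) :
    Δ ≤ ∑ i ∈ D, (if (N i : ℝ) ≤ 4 * m ^ 2 * (θ * G i / δ i ^ 2) then
      2 * Real.sqrt (θ * G i / N i) else 0) := by
  have hm1 : (1 : ℝ) ≤ m := by exact_mod_cast hm
  have hsum : Δ ≤ ∑ i ∈ D, Real.sqrt (θ * G i / N i) := by
    have e : ∑ i ∈ D, Real.sqrt (θ * G i / N i) =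
        Real.sqrt θ * ∑ i ∈ D, Real.sqrt (G i / N i) := by
      rw [Finset.mul_sum]
      refine Finset.sum_congr rfl fun i _ => ?_
      rw [mul_div_assoc, Real.sqrt_mul hθ]
    rw [e]
    refine abs_le_of_sq_le_sq' ?_ (by positivity) |>.2
    rw [mul_pow, Real.sq_sqrt hθ]
    exact h
  -- The same subtraction at the level of standard deviations: beyond the threshold each is at most
  -- `Δ / (2 m)`, whence the factor `4 m²`.
  have h1 : Δ ≤ ∑ i ∈ D, (2 * Real.sqrt (θ * G i / N i) - Δ / m) := by
    rw [Finset.sum_sub_distrib, Finset.sum_const, hD, nsmul_eq_mul,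
      mul_div_cancel₀ _ (by positivity), ← Finset.mul_sum]
    linarith
  refine h1.trans (Finset.sum_le_sum fun i hi => ?_)
  have h2 : 0 < (N i : ℝ) := by exact_mod_cast hN i hi
  obtain ⟨h3, h4⟩ := hδ i hi
  have h5 : 0 ≤ θ * G i := mul_nonneg hθ (hG i)
  by_cases hcond : (N i : ℝ) ≤ 4 * m ^ 2 * (θ * G i / δ i ^ 2)
  · rw [if_pos hcond]
    have : 0 ≤ Δ / m := by positivity
    linarith
  · rw [if_neg hcond, sub_nonpos]
    push Not at hcond
    have h6 : Real.sqrt (θ * G i / N i) ≤ Δ / (2 * m) := by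
      rw [Real.sqrt_le_left (by positivity), div_pow, div_le_div_iff₀ h2 (by positivity)]
      have h6 : 4 * m ^ 2 * (θ * G i / δ i ^ 2) * δ i ^ 2 < N i * δ i ^ 2 := by gcongr
      have h7 : 4 * m ^ 2 * (θ * G i / δ i ^ 2) * δ i ^ 2 = 4 * m ^ 2 * (θ * G i) := by field_simp
      have h8 : δ i ^ 2 ≤ Δ ^ 2 := by gcongr
      nlinarith
    calc 2 * Real.sqrt (θ * G i / N i) ≤ 2 * (Δ / (2 * m)) := by gcongr
      _ = Δ / m := by field_simp

/-- Along a run, each number of pulls of an arm is charged at most once. -/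
theorem sum_charge_le {a : ℕ → Finset (Fin d)} {S : Finset ℕ} {I : Finset (Fin d)} {T : ℕ}
    (hS : S ⊆ Finset.Icc 1 T) (hI : ∀ t ∈ S, ∀ i ∈ a t, i ∈ I)
    (hN : ∀ t ∈ S, ∀ i ∈ a t, pulls a t i ≠ 0) {h : Fin d → ℕ → ℝ} (hh : ∀ i ∈ I, ∀ n, 0 ≤ h i n) :
    ∑ t ∈ S, ∑ i ∈ a t, h i (pulls a t i) ≤ ∑ i ∈ I, ∑ n ∈ Finset.Icc 1 T, h i n := by
  have e : ∑ t ∈ S, ∑ i ∈ a t, h i (pulls a t i) =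
      ∑ i ∈ I, ∑ t ∈ S.filter (fun t => i ∈ a t), h i (pulls a t i) := by
    refine Finset.sum_comm' fun t i => ?_
    simp only [Finset.mem_filter]
    exact ⟨fun h => ⟨h, hI t h.1 i h.2⟩, fun h => h.1⟩
  rw [e]
  refine Finset.sum_le_sum fun i hi => ?_
  -- The count of an arm strictly increases between two stages at which it is played.
  have hinj : Set.InjOn (fun t => pulls a t i) (S.filter (fun t => i ∈ a t)) := by
    intro s hs t ht hst
    simp only [Finset.coe_filter, Set.mem_ofPred_eq] at hs ht
    have hs1 := (Finset.mem_Icc.1 (hS hs.1)).1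
    have ht1 := (Finset.mem_Icc.1 (hS ht.1)).1
    simp only at hst
    rcases lt_trichotomy s t with h1 | h1 | h1
    · have := pulls_lt_pulls a hs1 h1 hs.2
      omega
    · exact h1
    · have := pulls_lt_pulls a ht1 h1 ht.2
      omega
  rw [← Finset.sum_image (f := fun n => h i n) hinj]
  refine Finset.sum_le_sum_of_subset_of_nonneg ?_ fun n _ _ => hh i hi n
  intro n hn
  obtain ⟨t, ht, rfl⟩ := Finset.mem_image.1 hn
  obtain ⟨ht1, ht2⟩ := Finset.mem_filter.1 ht
  obtain ⟨h1, h2⟩ := Finset.mem_Icc.1 (hS ht1)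
  have h3 := hN t ht1 i ht2
  have h4 := pulls_lt a h1 i
  exact Finset.mem_Icc.2 ⟨by omega, by omega⟩

/-- The constant `80 / 9`, multiplied by the `9` of the dominance split, produces `80 = 16 * 5`. -/
theorem four_add_two_log_le (hm : 1 ≤ m) :
    4 + 2 * Real.log (2 * m) ≤ 80 / 9 * (posCeil (Real.log m / 1.6) : ℝ) ^ 2 := by
  have h1 : (1 : ℝ) ≤ posCeil (Real.log m / 1.6) := by
    exact_mod_cast le_max_left _ _
  have h2 : Real.log m / 1.6 ≤ posCeil (Real.log m / 1.6) :=
    (Nat.le_ceil _).trans (by exact_mod_cast le_max_right _ _)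
  have hm1 : (1 : ℝ) ≤ m := by exact_mod_cast hm
  rw [Real.log_mul (by norm_num) (by linarith)]
  rw [div_le_iff₀ (by norm_num)] at h2
  have := Real.log_two_lt_d9
  set L : ℝ := (posCeil (Real.log m / 1.6) : ℝ)
  nlinarith

/-! ### Correlations and the width of a played action. -/

/-- The form at `x e_i + e_j` is a quadratic polynomial in `x` without sign change, so its
discriminant is nonpositive. -/
theorem sq_apply_le_of_posSemidef {Γ : Matrix (Fin d) (Fin d) ℝ} (hΓ : Γ.PosSemidef)
    (i j : Fin d) : Γ i j ^ 2 ≤ Γ i i * Γ j j := by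
  have hsymm : Γ j i = Γ i j := by simpa using hΓ.isHermitian.apply i j
  have h : ∀ x : ℝ, 0 ≤ Γ i i * (x * x) + 2 * Γ i j * x + Γ j j := by
    intro x
    have h1 := hΓ.dotProduct_mulVec_nonneg (Pi.single i x + Pi.single j 1)
    simp only [star_trivial, Matrix.mulVec_add, dotProduct_add, add_dotProduct,
      single_dotProduct, Matrix.mulVec_single, Matrix.col_apply, Pi.smul_apply,
      MulOpposite.smul_eq_mul_unop, MulOpposite.unop_op, hsymm] at h1
    linarith
  have := discrim_le_zero h
  unfold discrim at this
  linarith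

theorem abs_apply_le_sqrt {Γ : Matrix (Fin d) (Fin d) ℝ} (hΓ : Γ.PosSemidef)
    (i j : Fin d) : |Γ i j| ≤ Real.sqrt (Γ i i * Γ j j) :=
  Real.abs_le_sqrt (sq_apply_le_of_posSemidef hΓ i j)

theorem corr_le_one {Γ : Matrix (Fin d) (Fin d) ℝ} (hΓ : Γ.PosSemidef) (A : Finset (Fin d)) :
    corr Γ A ≤ 1 := by
  refine Real.iSup_le (fun p => ?_) zero_le_one
  exact div_le_one_of_le₀ ((le_abs_self _).trans (abs_apply_le_sqrt hΓ _ _)) (Real.sqrt_nonneg _)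

theorem maxCorr_le_one {Γ : Matrix (Fin d) (Fin d) ℝ} (hΓ : Γ.PosSemidef)
    (a : ℕ → Finset (Fin d)) (T : ℕ) : maxCorr Γ a T ≤ 1 :=
  Real.iSup_le (fun t => corr_le_one hΓ (a t)) zero_le_one

theorem maxCorr_nonneg {Γ : Matrix (Fin d) (Fin d) ℝ} (hΓ0 : ∀ i j, 0 ≤ Γ i j)
    (a : ℕ → Finset (Fin d)) (T : ℕ) : 0 ≤ maxCorr Γ a T :=
  Real.iSup_nonneg fun _ => Real.iSup_nonneg fun _ => div_nonneg (hΓ0 _ _) (Real.sqrt_nonneg _)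

theorem apply_le_maxCorr_mul_sqrt {Γ : Matrix (Fin d) (Fin d) ℝ} (hΓ : Γ.PosSemidef)
    {a : ℕ → Finset (Fin d)} {t T : ℕ} (ht : t ∈ Finset.Icc 1 T) {i j : Fin d} (hi : i ∈ a t)
    (hj : j ∈ a t) (hij : i ≠ j) :
    Γ i j ≤ maxCorr Γ a T * Real.sqrt (Γ i i * Γ j j) := by
  have h1 : Γ i j / Real.sqrt (Γ i i * Γ j j) ≤ corr Γ (a t) :=
    le_ciSup (f := fun p : (a t).offDiag =>
      Γ p.1.1 p.1.2 / Real.sqrt (Γ p.1.1 p.1.1 * Γ p.1.2 p.1.2)) (Set.finite_range _).bddAbove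
      ⟨(i, j), Finset.mem_offDiag.2 ⟨hi, hj, hij⟩⟩
  have h2 : corr Γ (a t) ≤ maxCorr Γ a T :=
    le_ciSup (f := fun t : Finset.Icc 1 T => corr Γ (a t)) (Set.finite_range _).bddAbove ⟨t, ht⟩
  have h3 := abs_apply_le_sqrt hΓ i j
  -- If a diagonal entry vanishes, so does `Γ i j`; hence the convention `0 / 0 = 0` in `corr` is
  -- harmless.
  rcases (Real.sqrt_nonneg (Γ i i * Γ j j)).eq_or_lt with h0 | h0
  · rw [← h0] at h3 ⊢
    simpa using (le_abs_self _).trans h3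
  · rw [← div_le_iff₀ h0]
    exact h1.trans h2

theorem covSum_le_mul_pulls {Γ : Matrix (Fin d) (Fin d) ℝ} (hΓ0 : ∀ i j, 0 ≤ Γ i j)
    (B : Finset (Fin d)) (a : ℕ → Finset (Fin d)) (t : ℕ) (i j : Fin d) :
    covSum B Γ a t i j ≤ Γ i j * pulls a t i ∧ covSum B Γ a t i j ≤ Γ i j * pulls a t j := by
  unfold covSum pulls
  rw [Finset.card_filter, Finset.card_filter]
  push_cast
  rw [Finset.mul_sum, Finset.mul_sum]
  constructor <;> refine Finset.sum_le_sum fun s _ => ?_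
  · by_cases h1 : i ∈ a s
    · split_ifs <;> simp_all
    · simp [h1]
  · by_cases h1 : j ∈ a s
    · split_ifs <;> simp_all
    · simp [h1]

/-- The width of the confidence interval of a played action in terms of the maximal correlation. -/
theorem widthSq_le {Γ : Matrix (Fin d) (Fin d) ℝ} (hΓ : Γ.PosSemidef) (hΓ0 : ∀ i j, 0 ≤ Γ i j)
    (lam : ℝ) {a : ℕ → Finset (Fin d)} {t T : ℕ} (ht : t ∈ Finset.Icc 1 T)
    (hN : ∀ i, pulls a t i ≠ 0) :
    widthSq Γ lam a t (a t) ≤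
      (lam + 1 - maxCorr Γ a T) * ∑ i ∈ a t, Γ i i / (pulls a t i : ℝ) +
        maxCorr Γ a T * (∑ i ∈ a t, Real.sqrt (Γ i i / (pulls a t i : ℝ))) ^ 2 := by
  set γ := maxCorr Γ a T with hγ
  have hγ0 : 0 ≤ γ := maxCorr_nonneg hΓ0 a T
  have hNp : ∀ i, 0 < (pulls a t i : ℝ) := fun i => by exact_mod_cast Nat.pos_of_ne_zero (hN i)
  set y : Fin d → ℝ := fun i => Real.sqrt (Γ i i / (pulls a t i : ℝ)) with hy
  have hyy : ∀ i, y i * y i = Γ i i / (pulls a t i : ℝ) := fun i =>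
    Real.mul_self_sqrt (div_nonneg (hΓ0 i i) (hNp i).le)
  have hrestr : ∑ i, ∑ j, covSum (a t) Γ a t i j * (pulls a t i : ℝ)⁻¹ * (pulls a t j : ℝ)⁻¹ =
      ∑ i ∈ a t, ∑ j ∈ a t,
        covSum (a t) Γ a t i j * (pulls a t i : ℝ)⁻¹ * (pulls a t j : ℝ)⁻¹ := by
    symm
    refine (Finset.sum_subset (Finset.subset_univ _) fun i _ hi => ?_).trans
      (Finset.sum_congr rfl fun i _ => Finset.sum_subset (Finset.subset_univ _) fun j _ hj => ?_)
    · refine Finset.sum_eq_zero fun j _ => ?_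
      simp [covSum, hi]
    · simp [covSum, hj]
  -- Off the diagonal, the number of joint pulls is at most the smaller count, hence at most `√(N_i
  -- N_j)`, which gives `γ y_i y_j`. On the diagonal, a share `γ` is set aside to complete the
  -- square `(∑ y_i)²`.
  have hterm : ∀ i ∈ a t, ∀ j ∈ a t,
      covSum (a t) Γ a t i j * (pulls a t i : ℝ)⁻¹ * (pulls a t j : ℝ)⁻¹ ≤
        (if i = j then (1 - γ) * (Γ i i / (pulls a t i : ℝ)) else 0) + γ * (y i * y j) := by
    intro i hi j hj
    have hi0 := hNp i
    have hj0 := hNp j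
    by_cases hij : i = j
    · subst hij
      rw [if_pos rfl, hyy, covSum_self, if_pos hi]
      refine le_of_eq ?_
      field_simp
      ring
    · rw [if_neg hij, zero_add]
      obtain ⟨h1, h2⟩ := covSum_le_mul_pulls hΓ0 (a t) a t i j
      have h3 := apply_le_maxCorr_mul_sqrt hΓ ht hi hj hij
      set g := Real.sqrt (Γ i i * Γ j j) with hg
      set s := Real.sqrt ((pulls a t i : ℝ) * pulls a t j) with hs
      have hs0 : 0 < s := Real.sqrt_pos.2 (by positivity)
      have hss : s * s = (pulls a t i : ℝ) * pulls a t j := Real.mul_self_sqrt (by positivity)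
      have h4 : covSum (a t) Γ a t i j ≤ Γ i j * s := by
        rcases le_total (pulls a t i : ℝ) (pulls a t j) with h | h
        · refine h1.trans (mul_le_mul_of_nonneg_left ?_ (hΓ0 i j))
          exact Real.le_sqrt_of_sq_le (by nlinarith)
        · refine h2.trans (mul_le_mul_of_nonneg_left ?_ (hΓ0 i j))
          exact Real.le_sqrt_of_sq_le (by nlinarith)
      have h5 : y i * y j = g / s := by
        simp only [hy, hg, hs]
        rw [← Real.sqrt_mul (div_nonneg (hΓ0 i i) hi0.le), div_mul_div_comm,
          Real.sqrt_div (mul_nonneg (hΓ0 i i) (hΓ0 j j))]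
      calc covSum (a t) Γ a t i j * (pulls a t i : ℝ)⁻¹ * (pulls a t j : ℝ)⁻¹
          = covSum (a t) Γ a t i j / (s * s) := by
            rw [hss]; field_simp
        _ ≤ (γ * g * s) / (s * s) := by
            gcongr
            exact h4.trans (by gcongr)
        _ = γ * (y i * y j) := by
            rw [h5]; field_simp
  unfold widthSq
  rw [hrestr]
  have h := Finset.sum_le_sum fun i hi => Finset.sum_le_sum fun j hj => hterm i hi j hj
  have e1 : ∑ i ∈ a t, ∑ j ∈ a t, ((if i = j then (1 - γ) * (Γ i i / (pulls a t i : ℝ)) else 0) +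
      γ * (y i * y j)) = (1 - γ) * ∑ i ∈ a t, Γ i i / (pulls a t i : ℝ) +
        γ * (∑ i ∈ a t, y i) ^ 2 := by
    simp only [Finset.sum_add_distrib]
    congr 1
    · rw [Finset.mul_sum]
      refine Finset.sum_congr rfl fun i hi => ?_
      rw [Finset.sum_ite_eq, if_pos hi]
    · rw [sq, Finset.sum_mul_sum, Finset.mul_sum]
      exact Finset.sum_congr rfl fun i _ => (Finset.mul_sum _ _ _).symm
  rw [e1] at h
  linarith

theorem explore_mono (m : ℕ) (lam : ℝ) {t T : ℕ} (ht : 2 ≤ t) (htT : t ≤ T) :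
    explore m lam t ≤ explore m lam T := by
  have h2 : (2 : ℝ) ≤ t := by exact_mod_cast ht
  have hT : (t : ℝ) ≤ T := by exact_mod_cast htT
  have h3 : 0 < Real.log t := Real.log_pos (by linarith)
  have h4 : Real.log t ≤ Real.log T := Real.log_le_log (by linarith) hT
  have h5 : Real.log (Real.log t) ≤ Real.log (Real.log T) := Real.log_le_log h3 h4
  unfold explore
  gcongr

/-! ### Properties of the gaps. -/

section Gaps

variable (𝒜 : ActionSet d m) (μ : Fin d → ℝ)

theorem armPosGaps_finite (i : Fin d) : (armPosGaps 𝒜 μ i).Finite := by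
  refine (𝒜.acts.finite_toSet.image (gap 𝒜 μ)).subset ?_
  rintro x ⟨A, hA, _, _, rfl⟩
  exact ⟨A, hA, rfl⟩

theorem armGapMin_pos {i : Fin d} (h : (armPosGaps 𝒜 μ i).Nonempty) : 0 < armGapMin 𝒜 μ i := by
  obtain ⟨A, _, _, h1, h2⟩ := h.csInf_mem (armPosGaps_finite 𝒜 μ i)
  rw [armGapMin, h2]
  exact h1

theorem complexity_nonneg {Γ : Matrix (Fin d) (Fin d) ℝ} (hΓ0 : ∀ i j, 0 ≤ Γ i j) :
    0 ≤ complexity 𝒜 μ Γ := by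
  classical
  exact Finset.sum_nonneg fun i hi =>
    div_nonneg (hΓ0 i i) (armGapMin_pos 𝒜 μ (Finset.mem_filter.1 hi).2).le

theorem posGaps_finite : (posGaps 𝒜 μ).Finite := by
  refine (𝒜.acts.finite_toSet.image (gap 𝒜 μ)).subset ?_
  rintro x ⟨A, hA, _, rfl⟩
  exact ⟨A, hA, rfl⟩

theorem gapMin_pos (h : (posGaps 𝒜 μ).Nonempty) : 0 < gapMin 𝒜 μ := by
  obtain ⟨A, _, h1, h2⟩ := h.csInf_mem (posGaps_finite 𝒜 μ)
  rw [gapMin, h2]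
  exact h1

variable {𝒜 μ}

theorem gapMin_le {A : Finset (Fin d)} (hA : A ∈ 𝒜.acts) (h : 0 < gap 𝒜 μ A) :
    gapMin 𝒜 μ ≤ gap 𝒜 μ A :=
  csInf_le (posGaps_finite 𝒜 μ).bddBelow ⟨A, hA, h, rfl⟩

theorem gap_nonneg {A : Finset (Fin d)} (hA : A ∈ 𝒜.acts) : 0 ≤ gap 𝒜 μ A :=
  sub_nonneg.2 (Finset.le_sup' _ hA)

theorem gap_le_gapMax {A : Finset (Fin d)} (hA : A ∈ 𝒜.acts) : gap 𝒜 μ A ≤ gapMax 𝒜 μ :=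
  Finset.le_sup' _ hA

theorem gapMax_nonneg : 0 ≤ gapMax 𝒜 μ := by
  obtain ⟨A, hA⟩ := 𝒜.nonempty
  exact (gap_nonneg hA).trans (gap_le_gapMax hA)

theorem armGapMin_le {A : Finset (Fin d)} (hA : A ∈ 𝒜.acts) (h : 0 < gap 𝒜 μ A) {i : Fin d}
    (hi : i ∈ A) : armGapMin 𝒜 μ i ≤ gap 𝒜 μ A :=
  csInf_le (armPosGaps_finite 𝒜 μ i).bddBelow ⟨A, hA, hi, h, rfl⟩

end Gaps

/-! ### Regret of the stages governed by the bonus. -/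

/-- The regret of the stages at which the gap is at most twice the exploration term. -/
theorem sum_gap_le_of_gap_le_bonus (hm : 1 ≤ m) (𝒜 : ActionSet d m) (μ : Fin d → ℝ)
    {Γ : Matrix (Fin d) (Fin d) ℝ} (hΓ : Γ.PosSemidef) (hΓ0 : ∀ i j, 0 ≤ Γ i j)
    {lam : ℝ} (hlam : 0 < lam) {a : ℕ → Finset (Fin d)} {T : ℕ} {S : Finset ℕ}
    (hS : S ⊆ Finset.Icc 2 T) (ha : ∀ t ∈ S, a t ∈ 𝒜.acts)
    (hN : ∀ t ∈ S, ∀ i, pulls a t i ≠ 0) (hpos : ∀ t ∈ S, 0 < gap 𝒜 μ (a t))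
    (hle : ∀ t ∈ S, gap 𝒜 μ (a t) ≤ 2 * bonus m Γ lam a t (a t)) :
    ∑ t ∈ S, gap 𝒜 μ (a t) ≤ 16 * max (explore m lam T) 0 * complexity 𝒜 μ Γ *
      (5 * (lam + 1 - maxCorr Γ a T) * (posCeil (Real.log m / 1.6) : ℝ) ^ 2
        + 45 * maxCorr Γ a T * m) := by
  classical
  -- `explore` may be negative at stage `2`; the square root in the bonus then vanishes, so the
  -- positive part is a valid bound.
  set f := max (explore m lam T) 0 with hf
  have hf0 : 0 ≤ f := le_max_right _ _
  set γ := maxCorr Γ a T with hγ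
  have hγ0 : 0 ≤ γ := maxCorr_nonneg hΓ0 a T
  have hγ1 : γ ≤ 1 := maxCorr_le_one hΓ a T
  set b := lam + 1 - γ with hb
  have hb0 : 0 ≤ b := by linarith
  set I := Finset.univ.filter (fun i => (armPosGaps 𝒜 μ i).Nonempty) with hI
  have hS1 : S ⊆ Finset.Icc 1 T := hS.trans (Finset.Icc_subset_Icc_left (by omega))
  set x : ℕ → ℝ := fun t => ∑ i ∈ a t, Γ i i / (pulls a t i : ℝ) with hx
  set y : ℕ → ℝ := fun t => ∑ i ∈ a t, Real.sqrt (Γ i i / (pulls a t i : ℝ)) with hy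
  have hmain : ∀ t ∈ S, gap 𝒜 μ (a t) ^ 2 ≤ 8 * f * (b * x t + γ * y t ^ 2) := by
    intro t ht
    have ht2 := Finset.mem_Icc.1 (hS ht)
    have h1 := hle t ht
    rw [bonus_eq Γ lam (hN t ht)] at h1
    have h2 := widthSq_le hΓ hΓ0 lam (hS1 ht) (hN t ht)
    have hW0 : 0 ≤ widthSq Γ lam a t (a t) := by
      refine add_nonneg (mul_nonneg hlam.le (Finset.sum_nonneg fun i _ =>
        div_nonneg (hΓ0 i i) (Nat.cast_nonneg _))) (sum_covSum_nonneg hΓ _ _ _ _)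
    have hfe : explore m lam t ≤ f := (explore_mono m lam ht2.1 ht2.2).trans (le_max_left _ _)
    have h3 : gap 𝒜 μ (a t) ≤
        2 * (Real.sqrt (2 * f) * Real.sqrt (b * x t + γ * y t ^ 2)) :=
      h1.trans (by gcongr)
    calc gap 𝒜 μ (a t) ^ 2 ≤
          (2 * (Real.sqrt (2 * f) * Real.sqrt (b * x t + γ * y t ^ 2))) ^ 2 := by
          have := (hpos t ht).le
          gcongr
      _ = 8 * f * (b * x t + γ * y t ^ 2) := by
          rw [mul_pow, mul_pow, Real.sq_sqrt (by positivity), Real.sq_sqrt (hW0.trans h2)]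
          ring
  have hδI : ∀ i ∈ I, 0 < armGapMin 𝒜 μ i := fun i hi =>
    armGapMin_pos 𝒜 μ (Finset.mem_filter.1 hi).2
  have hSI : ∀ t ∈ S, ∀ i ∈ a t, i ∈ I := fun t ht i hi =>
    Finset.mem_filter.2 ⟨Finset.mem_univ _, _, a t, ha t ht, hi, hpos t ht, rfl⟩
  have hδ : ∀ t ∈ S, ∀ i ∈ a t, 0 < armGapMin 𝒜 μ i ∧ armGapMin 𝒜 μ i ≤ gap 𝒜 μ (a t) :=
    fun t ht i hi => ⟨hδI i (hSI t ht i hi), armGapMin_le (ha t ht) (hpos t ht) hi⟩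
  have hN1 : ∀ t ∈ S, ∀ i ∈ a t, 1 ≤ pulls a t i := fun t ht i _ =>
    Nat.pos_of_ne_zero (hN t ht i)
  -- Outside `S₁`, `8 f b x` is below `8/9` of the squared gap, so the remaining ninth is at most `8
  -- f γ y²`; this gives the factor `72` in the second bound.
  set S₁ := S.filter (fun t => gap 𝒜 μ (a t) ^ 2 ≤ 9 * f * b * x t) with hS₁
  set S₂ := S.filter (fun t => ¬ gap 𝒜 μ (a t) ^ 2 ≤ 9 * f * b * x t) with hS₂
  have hsub₁ : S₁ ⊆ S := Finset.filter_subset _ _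
  have hsub₂ : S₂ ⊆ S := Finset.filter_subset _ _
  have hcplx : complexity 𝒜 μ Γ = ∑ i ∈ I, Γ i i / armGapMin 𝒜 μ i := by
    unfold complexity
    refine Finset.sum_congr ?_ fun _ _ => rfl
    ext i
    simp [hI]
  have hcplx0 : 0 ≤ complexity 𝒜 μ Γ := complexity_nonneg 𝒜 μ hΓ0
  set L2 := (posCeil (Real.log m / 1.6) : ℝ) ^ 2 with hL2
  have bound₁ : ∑ t ∈ S₁, gap 𝒜 μ (a t) ≤ 80 * f * b * L2 * complexity 𝒜 μ Γ := by
    set θ := 9 * f * b with hθ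
    have hθ0 : 0 ≤ θ := by positivity
    have h1 : ∑ t ∈ S₁, gap 𝒜 μ (a t) ≤ ∑ t ∈ S₁, ∑ i ∈ a t,
        armGapMin 𝒜 μ i * (if (pulls a t i : ℝ) ≤ 2 * m * (θ * Γ i i / armGapMin 𝒜 μ i ^ 2) then
        2 * min (Real.sqrt (θ * Γ i i / armGapMin 𝒜 μ i ^ 2 / pulls a t i))
          (θ * Γ i i / armGapMin 𝒜 μ i ^ 2 / pulls a t i) else 0) :=
      Finset.sum_le_sum fun t ht => gap_le_sum_charge_of_sum (𝒜.card_eq _ (ha t (hsub₁ ht))) hm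
        (G := fun i => Γ i i) (hpos t (hsub₁ ht)) hθ0 (fun i => hΓ0 i i) (hδ t (hsub₁ ht))
        (hN1 t (hsub₁ ht)) (Finset.mem_filter.1 ht).2
    refine h1.trans ((sum_charge_le (hsub₁.trans hS1) (fun t ht => hSI t (hsub₁ ht))
      (fun t ht i _ => hN t (hsub₁ ht) i) (h := fun i n => armGapMin 𝒜 μ i *
        (if (n : ℝ) ≤ 2 * m * (θ * Γ i i / armGapMin 𝒜 μ i ^ 2) then
        2 * min (Real.sqrt (θ * Γ i i / armGapMin 𝒜 μ i ^ 2 / n))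
          (θ * Γ i i / armGapMin 𝒜 μ i ^ 2 / n) else 0)) ?_).trans ?_)
    · intro i hi n
      have h2 := hδI i hi
      have h3 := hΓ0 i i
      split_ifs <;> positivity
    · rw [hcplx, Finset.mul_sum]
      refine Finset.sum_le_sum fun i hi => ?_
      have h2 := hδI i hi
      have h3 := hΓ0 i i
      rw [← Finset.mul_sum]
      have h4 := sum_truncated_min_le (K := θ * Γ i i / armGapMin 𝒜 μ i ^ 2) (by positivity) hm T
      have h5 := four_add_two_log_le hm
      calc _ ≤ armGapMin 𝒜 μ i *
            (θ * Γ i i / armGapMin 𝒜 μ i ^ 2 * (80 / 9 * L2)) := by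
            gcongr
            exact h4.trans (by gcongr)
        _ = 80 * f * b * L2 * (Γ i i / armGapMin 𝒜 μ i) := by
            rw [hθ]
            field_simp
  have bound₂ : ∑ t ∈ S₂, gap 𝒜 μ (a t) ≤ 576 * f * γ * m * complexity 𝒜 μ Γ := by
    set θ := 72 * f * γ with hθ
    have hθ0 : 0 ≤ θ := by positivity
    have h1 : ∑ t ∈ S₂, gap 𝒜 μ (a t) ≤ ∑ t ∈ S₂, ∑ i ∈ a t,
        (if (pulls a t i : ℝ) ≤ 4 * m ^ 2 * (θ * Γ i i / armGapMin 𝒜 μ i ^ 2) then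
        2 * Real.sqrt (θ * Γ i i / pulls a t i) else 0) := by
      refine Finset.sum_le_sum fun t ht => gap_le_sum_charge_of_sq_sum
        (𝒜.card_eq _ (ha t (hsub₂ ht))) hm (G := fun i => Γ i i) (hpos t (hsub₂ ht)) hθ0
        (fun i => hΓ0 i i) (hδ t (hsub₂ ht)) (hN1 t (hsub₂ ht)) ?_
      have h2 := hmain t (hsub₂ ht)
      have h3 := (Finset.mem_filter.1 ht).2
      push Not at h3
      change _ ≤ θ * y t ^ 2
      rw [hθ]
      nlinarith
    refine h1.trans ((sum_charge_le (hsub₂.trans hS1) (fun t ht => hSI t (hsub₂ ht))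
      (fun t ht i _ => hN t (hsub₂ ht) i) (h := fun i n =>
        (if (n : ℝ) ≤ 4 * m ^ 2 * (θ * Γ i i / armGapMin 𝒜 μ i ^ 2) then
        2 * Real.sqrt (θ * Γ i i / n) else 0)) ?_).trans ?_)
    · intro i hi n
      split_ifs <;> positivity
    · rw [hcplx, Finset.mul_sum]
      refine Finset.sum_le_sum fun i hi => ?_
      have h2 := hδI i hi
      have h3 := hΓ0 i i
      refine (sum_two_mul_sqrt_div_le (by positivity) (by positivity) T).trans (le_of_eq ?_)
      have e : θ * Γ i i * (4 * m ^ 2 * (θ * Γ i i / armGapMin 𝒜 μ i ^ 2)) =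
          (2 * m * (θ * Γ i i) / armGapMin 𝒜 μ i) ^ 2 := by
        field_simp
        ring
      rw [e, Real.sqrt_sq (by positivity), hθ]
      ring
  rw [← Finset.sum_filter_add_sum_filter_not S (fun t => gap 𝒜 μ (a t) ^ 2 ≤ 9 * f * b * x t)]
  -- The charging gives `576 = 8 * 72`; the stated constant is `720 = 16 * 45`.
  have h6 : 576 * f * γ * m * complexity 𝒜 μ Γ ≤ 720 * f * γ * m * complexity 𝒜 μ Γ := by
    gcongr
    norm_num
  calc _ ≤ 80 * f * b * L2 * complexity 𝒜 μ Γ + 720 * f * γ * m * complexity 𝒜 μ Γ :=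
        add_le_add bound₁ (bound₂.trans h6)
    _ = _ := by ring

/-! ### Pathwise decomposition of the regret. -/

theorem muHat_sub (μ : Fin d → ℝ) {a : ℕ → Finset (Fin d)} (x : ℕ → Fin d → ℝ) {t : ℕ}
    {i : Fin d} (hN : pulls a t i ≠ 0) :
    pulls a t i * (muHat a x t i - μ i) =
      ∑ s ∈ Finset.Ico 1 t, if i ∈ a s then x s i - μ i else 0 := by
  have h0 : (pulls a t i : ℝ) ≠ 0 := by exact_mod_cast hN
  have e2 : (∑ s ∈ Finset.Ico 1 t, if i ∈ a s then x s i - μ i else 0) =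
      ∑ s ∈ (Finset.Ico 1 t).filter (fun s => i ∈ a s), x s i - pulls a t i * μ i := by
    simp [Finset.sum_ite, pulls]
  rw [e2, muHat]
  field_simp

section Probability

variable [mΩ : MeasurableSpace Ω] {P : Measure Ω} [IsProbabilityMeasure P] {ℱ : Filtration ℕ mΩ}
  {𝒜 : ActionSet d m} {X : ℕ → Ω → Fin d → ℝ} {μ : Fin d → ℝ} {C Γ : Matrix (Fin d) (Fin d) ℝ}
  {lam : ℝ} {A : ℕ → Ω → Finset (Fin d)} {τ : Ω → ℕ}

theorem IsOLSUCB.pulls_ne_zero (hA : IsOLSUCB 𝒜 Γ lam ℱ X A τ) {ω : Ω} {t : ℕ} (ht : τ ω < t)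
    (i : Fin d) : pulls (fun s => A s ω) t i ≠ 0 := by
  obtain ⟨s, h1, h2, h3⟩ := hA.init ω i
  refine Finset.card_ne_zero_of_mem (a := s) ?_
  simp only [Finset.mem_filter, Finset.mem_Ico]
  exact ⟨⟨h1, by omega⟩, h3⟩

/-- The event that the index of `B` at stage `t` is below its mean reward. -/
def pessimismEvent (m : ℕ) (Γ : Matrix (Fin d) (Fin d) ℝ) (lam : ℝ) (X : ℕ → Ω → Fin d → ℝ)
    (μ : Fin d → ℝ) (A : ℕ → Ω → Finset (Fin d)) (B : Finset (Fin d)) (t : ℕ) : Set Ω :=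
  {ω | (∀ i, pulls (fun s => A s ω) t i ≠ 0) ∧
    index m Γ lam (fun s => A s ω) (fun s => X s ω) t B < meanReward μ B}

/-- A suboptimal action is played only if its gap is small compared to its exploration term, the
mean of one of its arms is overestimated, or the mean of the best action is underestimated. -/
theorem gap_le_two_mul_bonus (hm : 1 ≤ m) (hA : IsOLSUCB 𝒜 Γ lam ℱ X A τ) {ω : Ω} {t T : ℕ}
    (ht : τ ω < t) (htT : t ≤ T) {B : Finset (Fin d)} (hB : B ∈ 𝒜.acts)
    (hBmax : 𝒜.acts.sup' 𝒜.nonempty (meanReward μ) = meanReward μ B)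
    (hpos : 0 < gap 𝒜 μ (A t ω)) (hF : ω ∉ pessimismEvent m Γ lam X μ A B t)
    (hE : ∀ i ∈ A t ω, ω ∉ deviationEvent X μ A T (gapMin 𝒜 μ / (2 * m)) i
      (pulls (fun s => A s ω) t i)) :
    gap 𝒜 μ (A t ω) ≤ 2 * bonus m Γ lam (fun s => A s ω) t (A t ω) := by
  have hm1 : (1 : ℝ) ≤ m := by exact_mod_cast hm
  have hmem := hA.mem t (by omega) ω
  have hN := hA.pulls_ne_zero ht
  have hF' : meanReward μ B ≤ index m Γ lam (fun s => A s ω) (fun s => X s ω) t B := by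
    by_contra h
    exact hF ⟨hN, not_le.1 h⟩
  have h1 := hF'.trans (hA.argmax ω t ht B hB)
  have h2 : ∀ i ∈ A t ω, muHat (fun s => A s ω) (fun s => X s ω) t i ≤
      μ i + gapMin 𝒜 μ / (2 * m) := by
    intro i hi
    by_contra h
    push Not at h
    refine hE i hi ⟨t, htT, rfl, ?_⟩
    rw [← muHat_sub μ (a := fun s => A s ω) (fun s => X s ω) (hN i)]
    exact mul_le_mul_of_nonneg_left (by linarith) (Nat.cast_nonneg _)
  have h3 : ∑ i ∈ A t ω, muHat (fun s => A s ω) (fun s => X s ω) t i ≤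
      meanReward μ (A t ω) + gapMin 𝒜 μ / 2 := by
    refine (Finset.sum_le_sum h2).trans (le_of_eq ?_)
    rw [Finset.sum_add_distrib, Finset.sum_const, 𝒜.card_eq _ hmem, nsmul_eq_mul, meanReward]
    congr 1
    field_simp
  have h4 := gapMin_le hmem hpos
  have h5 : gap 𝒜 μ (A t ω) = meanReward μ B - meanReward μ (A t ω) := by rw [gap, hBmax]
  unfold index at h1
  linarith

/-- A stage not governed by its bonus costs at most `gapMax` and is paid for by an indicator. The
events enter through arbitrary supersets `E` and `F`, so that measurable hulls can be inserted
later. -/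
theorem regret_le (hm : 1 ≤ m) (hΓ : Γ.PosSemidef) (hΓ0 : ∀ i j, 0 ≤ Γ i j) (hlam : 0 < lam)
    (hA : IsOLSUCB 𝒜 Γ lam ℱ X A τ) {B : Finset (Fin d)} (hB : B ∈ 𝒜.acts)
    (hBmax : 𝒜.acts.sup' 𝒜.nonempty (meanReward μ) = meanReward μ B) (T : ℕ)
    {E : Fin d → ℕ → Set Ω}
    (hE : ∀ i n, deviationEvent X μ A T (gapMin 𝒜 μ / (2 * m)) i n ⊆ E i n)
    {F : ℕ → Set Ω} (hF : ∀ t, pessimismEvent m Γ lam X μ A B t ⊆ F t) (ω : Ω) :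
    regret 𝒜 μ (fun t => A t ω) T ≤ regret 𝒜 μ (fun t => A t ω) (min (τ ω) T) +
      16 * max (explore m lam T) 0 * complexity 𝒜 μ Γ *
        (5 * (lam + 1 - maxCorr Γ (fun t => A t ω) T) * (posCeil (Real.log m / 1.6) : ℝ) ^ 2
          + 45 * maxCorr Γ (fun t => A t ω) T * m) +
      gapMax 𝒜 μ * (∑ i, ∑ n ∈ Finset.Icc 1 T, (E i n).indicator (fun _ => (1 : ℝ)) ω +
        ∑ t ∈ Finset.Icc 2 T, (F t).indicator (fun _ => (1 : ℝ)) ω) := by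
  classical
  set a : ℕ → Finset (Fin d) := fun t => A t ω with ha
  set R := (Finset.Icc 1 T).filter (fun t => τ ω < t ∧ 0 < gap 𝒜 μ (a t)) with hR
  have hR1 : R ⊆ Finset.Icc 1 T := Finset.filter_subset _ _
  have hmem : ∀ t ∈ Finset.Icc 1 T, a t ∈ 𝒜.acts := fun t ht =>
    hA.mem t (Finset.mem_Icc.1 ht).1 ω
  have hN : ∀ t ∈ R, ∀ i, pulls a t i ≠ 0 := fun t ht i =>
    hA.pulls_ne_zero (Finset.mem_filter.1 ht).2.1 i
  -- Stage `1` cannot follow the initialization: no arm has been pulled before it, and an action has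
  -- at least one arm.
  have hR2 : R ⊆ Finset.Icc 2 T := by
    intro t ht
    have h1 := Finset.mem_Icc.1 (hR1 ht)
    have hcard := 𝒜.card_eq _ (hmem t (hR1 ht))
    obtain ⟨i, -⟩ : (a t).Nonempty := Finset.card_pos.1 (by omega)
    have h2 := hN t ht i
    have h3 := pulls_lt a h1.1 i
    exact Finset.mem_Icc.2 ⟨by omega, h1.2⟩
  have hind : ∀ (s : Set Ω), 0 ≤ s.indicator (fun _ => (1 : ℝ)) ω := fun s =>
    Set.indicator_nonneg (fun _ _ => zero_le_one) ω
  have hsplit : regret 𝒜 μ a T ≤ regret 𝒜 μ a (min (τ ω) T) + ∑ t ∈ R, gap 𝒜 μ (a t) := by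
    unfold regret
    have e : Finset.Icc 1 (min (τ ω) T) = (Finset.Icc 1 T).filter (fun t => ¬ τ ω < t) := by
      ext t
      simp only [Finset.mem_Icc, Finset.mem_filter, le_min_iff]
      omega
    rw [e, ← Finset.sum_filter_not_add_sum_filter (Finset.Icc 1 T) (fun t => τ ω < t)]
    refine add_le_add le_rfl ?_
    rw [hR, ← Finset.filter_filter, Finset.sum_filter (s := Finset.filter _ _)]
    refine Finset.sum_le_sum fun t ht => ?_
    split_ifs with h
    · exact le_rfl
    · exact not_lt.1 h
  set S := R.filter (fun t => gap 𝒜 μ (a t) ≤ 2 * bonus m Γ lam a t (a t)) with hS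
  have hSR : S ⊆ R := Finset.filter_subset _ _
  have hgood := sum_gap_le_of_gap_le_bonus hm 𝒜 μ hΓ hΓ0 hlam (a := a) (T := T) (S := S)
    (hSR.trans hR2) (fun t ht => hmem t (hR1 (hSR ht))) (fun t ht => hN t (hSR ht))
    (fun t ht => (Finset.mem_filter.1 (hSR ht)).2.2) (fun t ht => (Finset.mem_filter.1 ht).2)
  have hterm : ∀ t ∈ R, gap 𝒜 μ (a t) ≤
      (if gap 𝒜 μ (a t) ≤ 2 * bonus m Γ lam a t (a t) then gap 𝒜 μ (a t) else 0) +
      gapMax 𝒜 μ * (∑ i ∈ a t, (E i (pulls a t i)).indicator (fun _ => (1 : ℝ)) ω +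
        (F t).indicator (fun _ => (1 : ℝ)) ω) := by
    intro t ht
    have hs0 : 0 ≤ ∑ i ∈ a t, (E i (pulls a t i)).indicator (fun _ => (1 : ℝ)) ω :=
      Finset.sum_nonneg fun i _ => hind _
    have hM0 : 0 ≤ gapMax 𝒜 μ := gapMax_nonneg
    have hle := gap_le_gapMax (μ := μ) (hmem t (hR1 ht))
    obtain ⟨h1, h2, h3⟩ := Finset.mem_filter.1 ht
    by_cases hb : gap 𝒜 μ (a t) ≤ 2 * bonus m Γ lam a t (a t)
    · rw [if_pos hb]
      have := mul_nonneg hM0 (add_nonneg hs0 (hind (F t)))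
      linarith
    · rw [if_neg hb, zero_add]
      refine hle.trans (le_mul_of_one_le_right hM0 ?_)
      by_cases hFt : ω ∈ F t
      · rw [Set.indicator_of_mem hFt]
        linarith
      · have hex : ∃ i ∈ a t, ω ∈ E i (pulls a t i) := by
          by_contra hcon
          push Not at hcon
          exact hb (gap_le_two_mul_bonus hm hA h2 (Finset.mem_Icc.1 h1).2 hB hBmax h3
            (fun h => hFt (hF t h)) (fun i hi h => hcon i hi (hE _ _ h)))
        obtain ⟨i, hi, hiE⟩ := hex
        have h4 := Finset.single_le_sum
          (f := fun i => (E i (pulls a t i)).indicator (fun _ => (1 : ℝ)) ω)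
          (fun j _ => hind _) hi
        simp only [Set.indicator_of_mem hiE] at h4
        linarith [hind (F t)]
  have hsum := Finset.sum_le_sum hterm
  rw [Finset.sum_add_distrib, ← Finset.sum_filter, ← Finset.mul_sum, Finset.sum_add_distrib] at hsum
  have hch := sum_charge_le hR1 (I := Finset.univ) (fun _ _ _ _ => Finset.mem_univ _)
    (fun t ht i _ => hN t ht i) (h := fun i n => (E i n).indicator (fun _ => (1 : ℝ)) ω)
    (fun _ _ _ => hind _)
  have hFs : ∑ t ∈ R, (F t).indicator (fun _ => (1 : ℝ)) ω ≤
      ∑ t ∈ Finset.Icc 2 T, (F t).indicator (fun _ => (1 : ℝ)) ω :=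
    Finset.sum_le_sum_of_subset_of_nonneg hR2 fun _ _ _ => hind _
  have h7 := mul_le_mul_of_nonneg_left (add_le_add hch hFs) (gapMax_nonneg (𝒜 := 𝒜) (μ := μ))
  linarith

theorem integrable_of_finite_range {f : Ω → ℝ} (hf : Measurable f) (hfin : (Set.range f).Finite) :
    Integrable f P := by
  obtain ⟨c, hc⟩ := (hfin.image norm).bddAbove
  exact Integrable.of_bound hf.aestronglyMeasurable c
    (Filter.Eventually.of_forall fun ω => hc ⟨f ω, ⟨ω, rfl⟩, rfl⟩)

theorem IsOLSUCB.integrable_of_actions (hA : IsOLSUCB 𝒜 Γ lam ℱ X A τ) {T : ℕ}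
    {H : (ℕ → Finset (Fin d)) → ℝ}
    (hH : ∀ a b : ℕ → Finset (Fin d), (∀ s ∈ Finset.Icc 1 T, a s = b s) → H a = H b) :
    Integrable (fun ω => H (fun s => A s ω)) P := by
  have h := measurable_of_actions hA.predictable (n := T) (H := H) fun a b hab =>
    hH a b fun s hs => hab s (by simp only [Finset.mem_Icc] at *; omega)
  exact integrable_of_finite_range (h.1.mono (ℱ.le _) le_rfl) h.2

/-- `τ` need not be a function of the actions, so the sum is cut by indicators of the complements of
`{τ ≤ t - 1}`, which are measurable by the stopping property. -/
theorem IsOLSUCB.integrable_regret_min (hA : IsOLSUCB 𝒜 Γ lam ℱ X A τ) (μ : Fin d → ℝ) (T : ℕ) :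
    Integrable (fun ω => regret 𝒜 μ (fun t => A t ω) (min (τ ω) T)) P := by
  have e : (fun ω => regret 𝒜 μ (fun t => A t ω) (min (τ ω) T)) = fun ω =>
      ∑ t ∈ Finset.Icc 1 T, {ω | τ ω ≤ t - 1}ᶜ.indicator (fun ω => gap 𝒜 μ (A t ω)) ω := by
    funext ω
    have e2 : Finset.Icc 1 (min (τ ω) T) = (Finset.Icc 1 T).filter (fun t => ¬ τ ω ≤ t - 1) := by
      ext t
      simp only [Finset.mem_Icc, Finset.mem_filter, le_min_iff]
      omega
    rw [regret, e2, Finset.sum_filter]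
    refine Finset.sum_congr rfl fun t _ => ?_
    simp [Set.indicator_apply]
  rw [e]
  refine integrable_finsetSum _ fun t ht => Integrable.indicator ?_
    (ℱ.le _ _ (hA.stopping (t - 1))).compl
  exact hA.integrable_of_actions (T := T) (H := fun a => gap 𝒜 μ (a t)) fun a b h => by
    simp only [h t ht]

/-- The deviation bound starts at stage `3`; stage `2` is bounded by probability one. -/
theorem sum_measure_pessimismEvent_le (hm : 1 ≤ m) (hX : IsRewardProcess P ℱ X μ C)
    (hA : ∀ t B, MeasurableSet[ℱ t] {ω | A (t + 1) ω = B}) (hCΓ : LePos C Γ) (hlam : 0 < lam)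
    {B : Finset (Fin d)} (hB : B.card = m) (T : ℕ) :
    ∑ t ∈ Finset.Icc 2 T, P.real (pessimismEvent m Γ lam X μ A B t) ≤ 3 := by
  have hsub : Finset.Icc 2 T ⊆ insert 2 (Finset.Icc 3 T) := by
    intro t ht
    simp only [Finset.mem_insert, Finset.mem_Icc] at *
    omega
  have h3 : ∑ t ∈ Finset.Icc 3 T, P.real (pessimismEvent m Γ lam X μ A B t) ≤ 2 := by
    refine (Finset.sum_le_sum fun t ht => ?_).trans (sum_inv_mul_log_sq_le T)
    have h := measure_index_lt_meanReward_le hX hA hCΓ hlam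
      (Finset.card_pos.1 (by omega)) hB (Finset.mem_Icc.1 ht).1
    exact ENNReal.toReal_le_of_le_ofReal (by positivity) h
  calc _ ≤ ∑ t ∈ insert 2 (Finset.Icc 3 T), P.real (pessimismEvent m Γ lam X μ A B t) :=
        Finset.sum_le_sum_of_subset_of_nonneg hsub fun _ _ _ => measureReal_nonneg
    _ = P.real (pessimismEvent m Γ lam X μ A B 2) +
        ∑ t ∈ Finset.Icc 3 T, P.real (pessimismEvent m Γ lam X μ A B t) :=
        Finset.sum_insert (by simp)
    _ ≤ 1 + 2 := add_le_add measureReal_le_one h3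
    _ = 3 := by norm_num

end Probability

end SemiBandit

end

open SemiBandit

/-! ### Integration of the pathwise bound. -/

theorem theorem2 {d m : ℕ} (hm : 1 ≤ m) {Ω : Type*} [mΩ : MeasurableSpace Ω]
    (P : Measure Ω) [IsProbabilityMeasure P] (ℱ : Filtration ℕ mΩ)
    (𝒜 : SemiBandit.ActionSet d m) (μ : Fin d → ℝ) (C Γ : Matrix (Fin d) (Fin d) ℝ)
    (X : ℕ → Ω → Fin d → ℝ) (hX : SemiBandit.IsRewardProcess P ℱ X μ C)
    (hΓ : Γ.PosSemidef) (hΓ0 : ∀ i j, 0 ≤ Γ i j) (hCΓ : SemiBandit.LePos C Γ)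
    (lam : ℝ) (hlam : 0 < lam) (A : ℕ → Ω → Finset (Fin d)) (τ : Ω → ℕ)
    (hA : SemiBandit.IsOLSUCB 𝒜 Γ lam ℱ X A τ) (T : ℕ) (hT : 1 ≤ T) :
    ∫ ω, SemiBandit.regret 𝒜 μ (fun t => A t ω) T ∂P ≤
      ∫ ω, SemiBandit.regret 𝒜 μ (fun t => A t ω) (min (τ ω) T) ∂P
      + 16 * max (SemiBandit.explore m lam T) 0 * SemiBandit.complexity 𝒜 μ Γ *
          ∫ ω, (5 * (lam + 1 - SemiBandit.maxCorr Γ (fun t => A t ω) T) *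
                (SemiBandit.posCeil (Real.log m / 1.6) : ℝ) ^ 2
              + 45 * SemiBandit.maxCorr Γ (fun t => A t ω) T * m) ∂P
      + 8 * d * (m : ℝ) ^ 2 * (⨆ i, C i i) * SemiBandit.gapMax 𝒜 μ / SemiBandit.gapMin 𝒜 μ ^ 2
      + 4 * SemiBandit.gapMax 𝒜 μ := by
  have hM0 : 0 ≤ gapMax 𝒜 μ := gapMax_nonneg
  have hC0 : ∀ i, 0 ≤ C i i := fun i => hX.posSemidef.diag_nonneg
  have hm1 : (1 : ℝ) ≤ m := by exact_mod_cast hm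
  -- If all actions are optimal, `gapMin` is a default value; all regrets vanish and the right-hand
  -- side only has to be nonnegative.
  rcases (posGaps 𝒜 μ).eq_empty_or_nonempty with hemp | hne
  · have hgap : ∀ t, 1 ≤ t → ∀ ω, gap 𝒜 μ (A t ω) = 0 := by
      intro t ht ω
      have hmem := hA.mem t ht ω
      refine le_antisymm (not_lt.1 fun h => ?_) (gap_nonneg hmem)
      have : gap 𝒜 μ (A t ω) ∈ posGaps 𝒜 μ := ⟨A t ω, hmem, h, rfl⟩
      rw [hemp] at this
      exact this
    have hreg : ∀ ω n, regret 𝒜 μ (fun t => A t ω) n = 0 := fun ω n =>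
      Finset.sum_eq_zero fun t ht => hgap t (Finset.mem_Icc.1 ht).1 ω
    simp only [hreg, integral_zero, zero_add]
    have h1 : 0 ≤ ∫ ω, (5 * (lam + 1 - maxCorr Γ (fun t => A t ω) T) *
                (posCeil (Real.log m / 1.6) : ℝ) ^ 2
              + 45 * maxCorr Γ (fun t => A t ω) T * m) ∂P := by
      refine integral_nonneg fun ω => ?_
      have h2 := maxCorr_nonneg hΓ0 (fun t => A t ω) T
      have h3 := maxCorr_le_one hΓ (fun t => A t ω) T
      have h4 : 0 ≤ lam + 1 - maxCorr Γ (fun t => A t ω) T := by linarith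
      simp only [Pi.zero_apply]
      positivity
    have h2 : 0 ≤ ⨆ i, C i i := Real.iSup_nonneg hC0
    have h3 := complexity_nonneg 𝒜 μ hΓ0
    positivity
  · obtain ⟨B, hB, hBmax⟩ := Finset.exists_mem_eq_sup' 𝒜.nonempty (meanReward μ)
    have hg0 := gapMin_pos 𝒜 μ hne
    set ε := gapMin 𝒜 μ / (2 * m) with hε
    have hε0 : 0 < ε := by positivity
    -- Measurable hulls have the same probabilities and make the indicators integrable.
    set E : Fin d → ℕ → Set Ω := fun i n => toMeasurable P (deviationEvent X μ A T ε i n) with hE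
    set F : ℕ → Set Ω := fun t => toMeasurable P (pessimismEvent m Γ lam X μ A B t) with hF
    have hpath := regret_le hm hΓ hΓ0 hlam hA hB hBmax T (E := E) (F := F)
      (fun i n => subset_toMeasurable _ _) (fun t => subset_toMeasurable _ _)
    have hi0 : Integrable (fun ω => regret 𝒜 μ (fun t => A t ω) T) P :=
      hA.integrable_of_actions (H := fun a => regret 𝒜 μ a T) fun a b h =>
        Finset.sum_congr rfl fun t ht => by rw [h t ht]
    have hi1 : Integrable (fun ω => regret 𝒜 μ (fun t => A t ω) (min (τ ω) T)) P :=
      hA.integrable_regret_min μ T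
    have hi2 : Integrable (fun ω => 5 * (lam + 1 - maxCorr Γ (fun t => A t ω) T) *
                (posCeil (Real.log m / 1.6) : ℝ) ^ 2
              + 45 * maxCorr Γ (fun t => A t ω) T * m) P := by
      refine hA.integrable_of_actions (T := T) (H := fun a => 5 * (lam + 1 - maxCorr Γ a T) *
                (posCeil (Real.log m / 1.6) : ℝ) ^ 2 + 45 * maxCorr Γ a T * m) fun a b h => ?_
      have : maxCorr Γ a T = maxCorr Γ b T := iSup_congr fun t => by rw [h t t.2]
      simp only [this]
    have hiE : ∀ i n, Integrable (fun ω => (E i n).indicator (fun _ => (1 : ℝ)) ω) P := fun i n =>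
      (integrable_const 1).indicator (measurableSet_toMeasurable _ _)
    have hiF : ∀ t, Integrable (fun ω => (F t).indicator (fun _ => (1 : ℝ)) ω) P := fun t =>
      (integrable_const 1).indicator (measurableSet_toMeasurable _ _)
    have hIE : ∀ i n, ∫ ω, (E i n).indicator (fun _ => (1 : ℝ)) ω ∂P =
        P.real (deviationEvent X μ A T ε i n) := by
      intro i n
      rw [integral_indicator_const _ (measurableSet_toMeasurable _ _), smul_eq_mul, mul_one,
        measureReal_def, measure_toMeasurable, measureReal_def]
    have hIF : ∀ t, ∫ ω, (F t).indicator (fun _ => (1 : ℝ)) ω ∂P =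
        P.real (pessimismEvent m Γ lam X μ A B t) := by
      intro t
      rw [integral_indicator_const _ (measurableSet_toMeasurable _ _), smul_eq_mul, mul_one,
        measureReal_def, measure_toMeasurable, measureReal_def]
    have hsE : Integrable (fun ω => ∑ i, ∑ n ∈ Finset.Icc 1 T,
        (E i n).indicator (fun _ => (1 : ℝ)) ω) P :=
      integrable_finsetSum _ fun i _ => integrable_finsetSum _ fun n _ => hiE i n
    have hsF : Integrable (fun ω => ∑ t ∈ Finset.Icc 2 T,
        (F t).indicator (fun _ => (1 : ℝ)) ω) P :=
      integrable_finsetSum _ fun t _ => hiF t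
    -- With `ε = gapMin / (2 m)`, the bound `2 C_ii / ε²` of each arm is `8 m² C_ii / gapMin²`.
    have hbE : ∫ ω, ∑ i, ∑ n ∈ Finset.Icc 1 T, (E i n).indicator (fun _ => (1 : ℝ)) ω ∂P ≤
        8 * d * (m : ℝ) ^ 2 * (⨆ i, C i i) / gapMin 𝒜 μ ^ 2 := by
      rw [integral_finsetSum _ fun i _ => integrable_finsetSum _ fun n _ => hiE i n]
      calc _ ≤ ∑ _i : Fin d, 2 * (⨆ i, C i i) / ε ^ 2 := by
            refine Finset.sum_le_sum fun i _ => ?_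
            rw [integral_finsetSum _ fun n _ => hiE i n, Finset.sum_congr rfl fun n _ => hIE i n]
            refine (sum_measure_deviationEvent_le hX hA.predictable hε0 i T).trans ?_
            gcongr
            exact le_ciSup (f := fun i => C i i) (Set.finite_range _).bddAbove i
        _ = _ := by
            rw [Finset.sum_const, Finset.card_univ, Fintype.card_fin, nsmul_eq_mul, hε]
            field_simp
            ring
    have hbF : ∫ ω, ∑ t ∈ Finset.Icc 2 T, (F t).indicator (fun _ => (1 : ℝ)) ω ∂P ≤ 3 := by
      rw [integral_finsetSum _ fun t _ => hiF t, Finset.sum_congr rfl fun t _ => hIF t]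
      exact sum_measure_pessimismEvent_le hm hX hA.predictable hCΓ hlam (𝒜.card_eq _ hB) T
    set J : Ω → ℝ := fun ω => 5 * (lam + 1 - maxCorr Γ (fun t => A t ω) T) *
                (posCeil (Real.log m / 1.6) : ℝ) ^ 2
              + 45 * maxCorr Γ (fun t => A t ω) T * m with hJ
    set c := 16 * max (explore m lam T) 0 * complexity 𝒜 μ Γ with hc
    have hi3 : Integrable (fun ω =>
        regret 𝒜 μ (fun t => A t ω) (min (τ ω) T) + c * J ω) P := hi1.add (hi2.const_mul _)
    have hi4 : Integrable (fun ω => gapMax 𝒜 μ *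
        (∑ i, ∑ n ∈ Finset.Icc 1 T, (E i n).indicator (fun _ => (1 : ℝ)) ω +
          ∑ t ∈ Finset.Icc 2 T, (F t).indicator (fun _ => (1 : ℝ)) ω)) P :=
      (hsE.add hsF).const_mul _
    have hint := integral_mono hi0 (hi3.add hi4) hpath
    rw [integral_add' hi3 hi4, integral_add hi1 (hi2.const_mul _), integral_const_mul,
      integral_const_mul, integral_add hsE hsF] at hint
    have h8 := mul_le_mul_of_nonneg_left (add_le_add hbE hbF) hM0
    have h9 : gapMax 𝒜 μ * (8 * d * (m : ℝ) ^ 2 * (⨆ i, C i i) / gapMin 𝒜 μ ^ 2 + 3) =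
        8 * d * (m : ℝ) ^ 2 * (⨆ i, C i i) * gapMax 𝒜 μ / gapMin 𝒜 μ ^ 2 + 3 * gapMax 𝒜 μ := by
      ring
    rw [h9] at h8
    linarith
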